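/- Conventions. Let $K$ be a non-empty locally compact Hausdorff space, $M(K)$ the space of regular complex Borel measures on $K$, and $M^+(K)\subset M(K)$ the cone of finite non-negative ones with the cone topology, i.e. the weak topology induced by $C_c^+(K)\cup\{1\}$; $p_x$ is the point mass at $x$. $K$ is a semitopological semihypergroup if $M(K)$ carries a bilinear associative operation $*$ such that: (i) $\mu*\nu\in M^+(K)$ for $\mu,\nu\in M^+(K)$, and for each $\omega\in M^+(K)$ the maps $\mu\mapsto\omega*\mu$ and $\mu\mapsto\mu*\omega$ on $M^+(K)$ are continuous; (ii) for all $x,y\in K$, $p_x*p_y$ is a probability measure with compact support; (iii) $(x,y)\mapsto\operatorname{supp}(p_x*p_y)$ is continuous from $K\times K$ to the space of compact subsets of $K$ with the Michael (Vietoris) topology. For a bounded continuous $f:K\to\mathbb C$ put $L_xf(y)=\int_K f\,d(p_x*p_y)$. $AP(K)$ is the space of all bounded continuous $f$ such that $\{L_xf:x\in K\}$ is relatively compact in the supremum norm. $AP(K)$ is left amenable if there is $m\in AP(K)^*$ with $\|m\|=m(1)=1$ and $m(L_xf)=m(f)$ for all $x\in K$, $f\in AP(K)$. Let $(E,Q)$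 be a separated locally convex space, $Q$ being a family of seminorms that induces its topology, and let $C\subseteq E$ be non-empty, compact and convex. An action of $K$ on $C$ is a map $\pi:K\times C\to C$ such that $\pi(s,\pi(t,x))=\int_K\pi(\zeta,x)\,d(p_s*p_t)(\zeta)$ for all $s,t\in K$, $x\in C$ (a weak vector-valued integral), and such that $\pi(e,x)=x$ for all $x \in C$ whenever $e$ is a two-sided identity of $K$ (i.e. $p_x*p_e=p_e*p_x=p_x$ for all $x\in K$). It is separately continuous if $\pi$ is continuous in each variable, and non-expansive if $p(\pi(s,x)-\pi(s,y))\le p(x-y)$ for all $p\in Q$, $s\in K$, $x,y\in C$. A common fixed point is an $x\in C$ with $\pi(s,x)=x$ for all $s\in K$. Theorem. Let $K$ be a semitopological semihypergroup. Then $AP(K)$ is left amenable if and only if, for every separated locally convex space $(E,Q)$ and every non-empty compact convex $C\subseteq E$, every separately continuous, non-expansive action of $K$ on $C$ has a common fixed point. -/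

import Mathlib

open MeasureTheory Topology BoundedContinuousFunction CompactlySupported
open scoped NNReal ENNReal

universe u v

noncomputable section

namespace Semihyper

variable {K : Type*} [TopologicalSpace K] [MeasurableSpace K] [BorelSpace K]

/-! ### Regular complex Borel measures -/

/-- A measure dominated by a finite regular measure is regular. -/
theorem regular_of_le [T2Space K] {μ ν : Measure K} [IsFiniteMeasure μ] [μ.Regular]
    (h : ν ≤ μ) : ν.Regular := by
  have : IsFiniteMeasure ν := isFiniteMeasure_of_le μ h
  have : ν.InnerRegularCompactLTTop := by
    refine ⟨fun A hA r hr => ?_⟩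
    obtain ⟨hAm, -⟩ := hA
    have hpos : ν A - r ≠ 0 := (tsub_pos_of_lt hr).ne'
    obtain ⟨C, hCA, hC, hlt⟩ := hAm.exists_isCompact_sdiff_lt (μ := μ) (measure_ne_top μ A) hpos
    refine ⟨C, hCA, hC, ?_⟩
    have h1 : ν A ≤ ν C + ν (A \ C) := by
      rw [measure_add_sdiff hC.measurableSet.nullMeasurableSet]
      exact measure_mono Set.subset_union_right
    have h2 : ν (A \ C) < ν A - r := (h _).trans_lt hlt
    by_contra hcon
    have h3 : ν C ≤ r := not_lt.1 hcon
    have h4 : ν A < r + (ν A - r) :=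
      h1.trans_lt (ENNReal.add_lt_add_of_le_of_lt (measure_ne_top ν C) h3 h2)
    rw [add_tsub_cancel_of_le hr.le] at h4
    exact lt_irrefl _ h4
  infer_instance

variable (K) in
/-- `M(K)`: the complex vector space of all regular complex Borel measures on `K`, that is,
those whose total variation measure is (finite and) regular. -/
def M [T2Space K] : Submodule ℂ (ComplexMeasure K) where
  carrier := {c | IsFiniteMeasure (VectorMeasure.variation c) ∧
    (VectorMeasure.variation c).Regular}
  zero_mem' := by
    simp only [Set.mem_ofPred_eq, VectorMeasure.variation_zero]
    exact ⟨inferInstance, inferInstance⟩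
  add_mem' := by
    rintro a b ⟨ha, ha'⟩ ⟨hb, hb'⟩
    have hle := VectorMeasure.variation_add_le (μ := a) (ν := b)
    have : (VectorMeasure.variation a + VectorMeasure.variation b).Regular := by
      have : (VectorMeasure.variation a + VectorMeasure.variation b).InnerRegular := inferInstance
      infer_instance
    exact ⟨isFiniteMeasure_of_le _ hle, regular_of_le hle⟩
  smul_mem' := by
    rintro c a ⟨ha, ha'⟩
    simp only [Set.mem_ofPred_eq, VectorMeasure.variation_smul]
    exact ⟨inferInstance, inferInstance⟩

variable (K) in
/-- `M⁺(K)`: the finite non-negative regular Borel measures on `K`. -/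
def MPlus : Type _ := {μ : Measure K // IsFiniteMeasure μ ∧ μ.Regular}

namespace MPlus

/-- The underlying Borel measure. -/
def meas (μ : MPlus K) : Measure K := μ.1

instance (μ : MPlus K) : IsFiniteMeasure μ.meas := μ.2.1

instance (μ : MPlus K) : μ.meas.Regular := μ.2.2

/-- The inclusion of `M⁺(K)` into `M(K)`. -/
def toM [T2Space K] (μ : MPlus K) : M K :=
  ⟨μ.meas.toSignedMeasure.toComplexMeasure 0, by
    have hle : VectorMeasure.variation (μ.meas.toSignedMeasure.toComplexMeasure 0) ≤ μ.meas := by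
      refine VectorMeasure.variation_le_of_forall_enorm_le fun E hE => ?_
      have : (μ.meas.toSignedMeasure.toComplexMeasure 0) E = ((μ.meas.real E : ℝ) : ℂ) := by
        rw [SignedMeasure.toComplexMeasure_apply, Measure.toSignedMeasure_apply_measurable hE]
        rfl
      rw [this, ← ofReal_norm, Complex.norm_real, Real.norm_of_nonneg measureReal_nonneg]
      simp [measureReal_def]
    exact ⟨isFiniteMeasure_of_le _ hle, regular_of_le hle⟩⟩

/-- The cone topology on `M⁺(K)`: the weak topology induced by the non-negative compactly
supported continuous functions together with the constant function `1`. -/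
instance : TopologicalSpace (MPlus K) :=
  TopologicalSpace.induced
    (fun μ => ((fun f : C_c(K, ℝ≥0) => ∫ x, (f x : ℝ) ∂μ.meas), μ.meas.real Set.univ))
    inferInstance

/-- The point mass `p_x`. -/
def point [T2Space K] [LocallyCompactSpace K] (x : K) : MPlus K :=
  ⟨Measure.dirac x, inferInstance, by
    have : (Measure.dirac x).InnerRegular := by
      refine ⟨fun A hA r hr => ?_⟩
      by_cases hx : x ∈ A
      · refine ⟨{x}, by simpa using hx, isCompact_singleton, hr.trans_le ?_⟩
        simpa using (prob_le_one (μ := Measure.dirac x) (s := A))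
      · simp [Measure.dirac_apply' _ hA, hx] at hr
    infer_instance⟩

end MPlus

variable [T2Space K] [LocallyCompactSpace K]

/-! ### Integrals of bounded continuous functions depend continuously on a probability measure -/

section Narrow

set_option linter.unusedSectionVars false

variable {Y : Type*} [TopologicalSpace Y] {ρ : Y → MPlus K}

theorem continuous_integral_cc (hρ : Continuous ρ) (g : C_c(K, ℝ≥0)) :
    Continuous fun y => ∫ x, (g x : ℝ) ∂(ρ y).meas :=
  (continuous_apply g).comp (continuous_fst.comp (continuous_induced_dom.comp hρ))

theorem continuous_integral_nonneg (hρ : Continuous ρ)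
    (hprob : ∀ y, IsProbabilityMeasure (ρ y).meas) {F : K → ℝ} (hF : Continuous F) {B : ℝ}
    (h0 : ∀ x, 0 ≤ F x) (hB : ∀ x, F x ≤ B) :
    Continuous fun y => ∫ x, F x ∂(ρ y).meas := by
  have hFint : ∀ y, Integrable F (ρ y).meas := fun y =>
    Integrable.of_bound hF.aestronglyMeasurable B
      (Filter.Eventually.of_forall fun x => by rw [Real.norm_of_nonneg (h0 x)]; exact hB x)
  rw [continuous_iff_continuousAt]
  intro y₀
  have hBnn : 0 ≤ B := by
    obtain ⟨x⟩ : Nonempty K := nonempty_of_isProbabilityMeasure (ρ y₀).meas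
    exact (h0 x).trans (hB x)
  rw [ContinuousAt, Metric.tendsto_nhds]
  intro ε hε
  set δ : ℝ := ε / (4 * (B + 1)) with hδ
  have hδ0 : 0 < δ := by positivity
  obtain ⟨C, -, hC, hlt⟩ := (MeasurableSet.univ (α := K)).exists_isCompact_sdiff_lt
    (μ := (ρ y₀).meas) (measure_ne_top _ _) (ENNReal.ofReal_pos.2 hδ0).ne'
  obtain ⟨g, hg1, -, hgc, hg⟩ := exists_continuous_one_zero_of_isCompact hC isClosed_empty
    (Set.disjoint_empty C)
  have hgint : ∀ y, Integrable (fun x => g x) (ρ y).meas := fun y =>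
    Integrable.of_bound g.continuous.aestronglyMeasurable 1
      (Filter.Eventually.of_forall fun x => by
        rw [Real.norm_of_nonneg (hg x).1]; exact (hg x).2)
  have hgFint : ∀ y, Integrable (fun x => g x * F x) (ρ y).meas := fun y =>
    Integrable.of_bound (g.continuous.mul hF).aestronglyMeasurable B
      (Filter.Eventually.of_forall fun x => by
        rw [Real.norm_of_nonneg (mul_nonneg (hg x).1 (h0 x))]
        nlinarith [(hg x).1, (hg x).2, h0 x, hB x])
  let g₁ : C_c(K, ℝ≥0) := ⟨⟨fun x => (g x).toNNReal, by fun_prop⟩,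
    hgc.comp_left (g := Real.toNNReal) Real.toNNReal_zero⟩
  let g₂ : C_c(K, ℝ≥0) := ⟨⟨fun x => (g x * F x).toNNReal, by fun_prop⟩,
    (hgc.mul_right (f' := F)).comp_left (g := Real.toNNReal) Real.toNNReal_zero⟩
  have c₁ : Continuous fun y => ∫ x, g x ∂(ρ y).meas := by
    refine (continuous_integral_cc hρ g₁).congr fun y => integral_congr_ae ?_
    exact Filter.Eventually.of_forall fun x => Real.coe_toNNReal _ (hg x).1
  have c₂ : Continuous fun y => ∫ x, g x * F x ∂(ρ y).meas := by
    refine (continuous_integral_cc hρ g₂).congr fun y => integral_congr_ae ?_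
    exact Filter.Eventually.of_forall fun x => Real.coe_toNNReal _ (mul_nonneg (hg x).1 (h0 x))
  have hy₀ : 1 - δ < ∫ x, g x ∂(ρ y₀).meas := by
    have h1 : (ρ y₀).meas.real (Set.univ \ C) < δ := by
      rw [measureReal_def]
      exact (ENNReal.lt_ofReal_iff_toReal_lt (measure_ne_top _ _)).1 hlt
    have h2 : (ρ y₀).meas.real C + (ρ y₀).meas.real (Set.univ \ C) = 1 := by
      rw [← Set.compl_eq_univ_sdiff, measureReal_add_measureReal_compl hC.measurableSet]
      exact probReal_univ
    have h3 : (ρ y₀).meas.real C ≤ ∫ x, g x ∂(ρ y₀).meas := by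
      rw [← integral_indicator_one hC.measurableSet]
      refine integral_mono ((integrable_const (1 : ℝ)).indicator hC.measurableSet) (hgint y₀) ?_
      intro x
      by_cases hx : x ∈ C
      · simp [hx, hg1 hx]
      · simpa [hx] using (hg x).1
    linarith
  have key : ∀ y, |∫ x, F x ∂(ρ y).meas - ∫ x, g x * F x ∂(ρ y).meas|
      ≤ B * (1 - ∫ x, g x ∂(ρ y).meas) := by
    intro y
    have hp := hprob y
    rw [← integral_sub (hFint y) (hgFint y), abs_of_nonneg]
    · have : B * (1 - ∫ x, g x ∂(ρ y).meas) = ∫ x, B * (1 - g x) ∂(ρ y).meas := by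
        rw [integral_const_mul, integral_sub (integrable_const _) (hgint y)]
        simp
      rw [this]
      refine integral_mono ((hFint y).sub (hgFint y))
        (((integrable_const (1 : ℝ)).sub (hgint y)).const_mul B) fun x => ?_
      change F x - g x * F x ≤ B * (1 - g x)
      nlinarith [(hg x).1, (hg x).2, h0 x, hB x]
    · refine integral_nonneg fun x => ?_
      simp only [Pi.zero_apply]
      nlinarith [(hg x).1, (hg x).2, h0 x, hB x]
  have hBδ : B * δ ≤ ε / 4 := by
    rw [hδ, ← mul_div_assoc, div_le_div_iff₀ (by positivity) (by norm_num)]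
    nlinarith
  have e₁ : ∀ᶠ y in 𝓝 y₀, 1 - δ < ∫ x, g x ∂(ρ y).meas :=
    (c₁.continuousAt (x := y₀)).eventually (lt_mem_nhds hy₀)
  have e₂ := Metric.tendsto_nhds.1 (c₂.continuousAt (x := y₀)) (ε / 2) (by positivity)
  filter_upwards [e₁, e₂] with y h₁ h₂
  rw [Real.dist_eq] at h₂ ⊢
  have k₁ := key y
  have k₂ := key y₀
  have b₁ : B * (1 - ∫ x, g x ∂(ρ y).meas) ≤ B * δ :=
    mul_le_mul_of_nonneg_left (by linarith) hBnn
  have b₂ : B * (1 - ∫ x, g x ∂(ρ y₀).meas) ≤ B * δ :=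
    mul_le_mul_of_nonneg_left (by linarith) hBnn
  rw [abs_lt] at h₂ ⊢
  rw [abs_le] at k₁ k₂
  constructor <;> linarith [h₂.1, h₂.2, k₁.1, k₁.2, k₂.1, k₂.2]

theorem continuous_integral_real (hρ : Continuous ρ)
    (hprob : ∀ y, IsProbabilityMeasure (ρ y).meas) {F : K → ℝ} (hF : Continuous F) {B : ℝ}
    (hB : ∀ x, |F x| ≤ B) : Continuous fun y => ∫ x, F x ∂(ρ y).meas := by
  have h := continuous_integral_nonneg hρ hprob (F := fun x => F x + B) (B := 2 * B)
    (hF.add continuous_const) (fun x => by linarith [(abs_le.1 (hB x)).1])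
    (fun x => by linarith [(abs_le.1 (hB x)).2])
  refine (h.sub (continuous_const (y := B))).congr fun y => ?_
  have := hprob y
  change ∫ x, (F x + B) ∂(ρ y).meas - B = _
  rw [integral_add (Integrable.of_bound hF.aestronglyMeasurable B
    (Filter.Eventually.of_forall hB)) (integrable_const _)]
  simp

theorem continuous_integral_complex (hρ : Continuous ρ)
    (hprob : ∀ y, IsProbabilityMeasure (ρ y).meas) (f : K →ᵇ ℂ) :
    Continuous fun y => ∫ x, f x ∂(ρ y).meas := by
  have hint : ∀ y, Integrable (fun x => f x) (ρ y).meas := fun y => f.integrable _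
  have hre := continuous_integral_real hρ hprob (F := fun x => (f x).re) (B := ‖f‖)
    (by fun_prop) fun x => (Complex.abs_re_le_norm _).trans (f.norm_coe_le_norm x)
  have him := continuous_integral_real hρ hprob (F := fun x => (f x).im) (B := ‖f‖)
    (by fun_prop) fun x => (Complex.abs_im_le_norm _).trans (f.norm_coe_le_norm x)
  refine ((Complex.continuous_ofReal.comp hre).add
    ((Complex.continuous_ofReal.comp him).mul (continuous_const (y := Complex.I)))).congr fun y => ?_
  exact integral_re_add_im (𝕜 := ℂ) (hint y)

end Narrow

theorem MPlus.continuous_point : Continuous (MPlus.point : K → MPlus K) := by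
  refine continuous_induced_rng.2 (Continuous.prodMk (continuous_pi fun f => ?_) ?_)
  · have : (fun x : K => ∫ z, (f z : ℝ) ∂(MPlus.point x).meas) = fun x => (f x : ℝ) := by
      funext x
      exact integral_dirac _ _
    change Continuous fun x : K => ∫ z, (f z : ℝ) ∂(MPlus.point x).meas
    rw [this]
    fun_prop
  · have : (fun x : K => (MPlus.point x).meas.real Set.univ) = fun _ => 1 := by
      funext x
      simp [MPlus.point, MPlus.meas]
    change Continuous fun x : K => (MPlus.point x).meas.real Set.univ
    rw [this]
    exact continuous_const

/-! ### Semitopological semihypergroups -/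

variable (K) in
/-- A semitopological semihypergroup structure on the locally compact Hausdorff space `K`. -/
structure SemitopologicalSemihypergroup where
  /-- The convolution, a bilinear operation on `M(K)`. -/
  conv : M K →ₗ[ℂ] M K →ₗ[ℂ] M K
  /-- `(M(K), *)` is an associative algebra. -/
  conv_assoc : ∀ μ ν ω, conv (conv μ ν) ω = conv μ (conv ν ω)
  /-- The convolution is positive: it restricts to an operation on `M⁺(K)`. -/
  convPlus : MPlus K → MPlus K → MPlus K
  toM_convPlus : ∀ μ ν, (convPlus μ ν).toM = conv μ.toM ν.toM
  /-- On `M⁺(K)`, with the cone topology, the convolution is separately continuous. -/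
  continuous_convPlus_left : ∀ ω, Continuous fun μ => convPlus ω μ
  continuous_convPlus_right : ∀ ω, Continuous fun μ => convPlus μ ω
  /-- `p_x * p_y` is a probability measure with compact support. -/
  isProbabilityMeasure_point : ∀ x y,
    IsProbabilityMeasure (convPlus (MPlus.point x) (MPlus.point y)).meas
  isCompact_support : ∀ x y,
    IsCompact (convPlus (MPlus.point x) (MPlus.point y)).meas.support
  /-- `(x, y) ↦ supp (p_x * p_y)` is continuous into the compact subsets of `K` with the
  Michael (Vietoris) topology. -/
  continuous_support : Continuous[inferInstance, TopologicalSpace.vietoris K]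
    fun q : K × K => (convPlus (MPlus.point q.1) (MPlus.point q.2)).meas.support

namespace SemitopologicalSemihypergroup

variable (S : SemitopologicalSemihypergroup K)

/-- The measure `p_x * p_y`. -/
def pconv (x y : K) : Measure K := (S.convPlus (MPlus.point x) (MPlus.point y)).meas

instance (x y : K) : IsProbabilityMeasure (S.pconv x y) := S.isProbabilityMeasure_point x y

/-- `e` is a two-sided identity: `p_x * p_e = p_e * p_x = p_x` for all `x`. -/
def IsIdentity (e : K) : Prop :=
  ∀ x, S.pconv x e = Measure.dirac x ∧ S.pconv e x = Measure.dirac x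

/-- The left translation `f ↦ L_x f`, `L_x f y = ∫ f d(p_x * p_y)`, on bounded continuous
functions. -/
def leftTranslate (x : K) : (K →ᵇ ℂ) →ₗ[ℂ] (K →ᵇ ℂ) where
  toFun f := BoundedContinuousFunction.ofNormedAddCommGroup (fun y => ∫ z, f z ∂(S.pconv x y))
    (continuous_integral_complex ((S.continuous_convPlus_left (MPlus.point x)).comp
      MPlus.continuous_point) (fun y => S.isProbabilityMeasure_point x y) f) ‖f‖
    (fun y => by
      refine (norm_integral_le_of_norm_le_const (μ := S.pconv x y)
        (Filter.Eventually.of_forall fun z => f.norm_coe_le_norm z)).trans ?_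
      simp)
  map_add' f g := by
    ext y
    exact integral_add (f.integrable (S.pconv x y)) (g.integrable (S.pconv x y))
  map_smul' c f := by
    ext y
    exact integral_const_mul c _

theorem leftTranslate_apply (x : K) (f : K →ᵇ ℂ) (y : K) :
    S.leftTranslate x f y = ∫ z, f z ∂(S.pconv x y) := rfl

theorem leftTranslate_one (x : K) : S.leftTranslate x 1 = 1 := by
  ext y
  simp [leftTranslate_apply]

/-- `AP(K)`: the space of almost periodic functions, i.e. of the bounded continuous functions `f`
whose (left) orbit `{L_x f : x ∈ K}` is relatively compact in `C(K)` with the supremum norm. -/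
def AP : Submodule ℂ (K →ᵇ ℂ) where
  carrier := {f | IsCompact (closure (Set.range fun x => S.leftTranslate x f))}
  zero_mem' := by
    refine isCompact_singleton (x := (0 : K →ᵇ ℂ)) |>.of_isClosed_subset isClosed_closure
      (closure_minimal ?_ isClosed_singleton)
    rintro _ ⟨x, rfl⟩
    simp
  add_mem' := by
    intro f g hf hg
    have h := hf.add hg
    refine h.of_isClosed_subset isClosed_closure (closure_minimal ?_ h.isClosed)
    rintro _ ⟨x, rfl⟩
    simp only [map_add]
    exact Set.add_mem_add (subset_closure ⟨x, rfl⟩) (subset_closure ⟨x, rfl⟩)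
  smul_mem' := by
    intro c f hf
    have h := hf.image (continuous_const_smul c)
    refine h.of_isClosed_subset isClosed_closure (closure_minimal ?_ h.isClosed)
    rintro _ ⟨x, rfl⟩
    simp only [map_smul]
    exact ⟨_, subset_closure ⟨x, rfl⟩, rfl⟩

theorem one_mem_AP : (1 : K →ᵇ ℂ) ∈ S.AP := by
  refine isCompact_singleton (x := (1 : K →ᵇ ℂ)) |>.of_isClosed_subset isClosed_closure
    (closure_minimal ?_ isClosed_singleton)
  rintro _ ⟨x, rfl⟩
  simp [leftTranslate_one]

/-- A left invariant mean on `AP(K)`: a functional `m ∈ AP(K)*` with `‖m‖ = m 1 = 1` and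
`m (L_x f) = m f`. (As `AP(K)` is translation invariant, `L_x f` always lies in `AP(K)`; the element
`g` is `L_x f` seen as an element of `AP(K)`.) -/
structure IsLeftInvariantMean (m : S.AP →L[ℂ] ℂ) : Prop where
  norm_eq_one : ‖m‖ = 1
  map_one : m ⟨1, S.one_mem_AP⟩ = 1
  map_leftTranslate : ∀ (x : K) (f g : S.AP),
    (g : K →ᵇ ℂ) = S.leftTranslate x (f : K →ᵇ ℂ) → m g = m f

/-- `AP(K)` is left amenable: it admits a left invariant mean. -/
def IsLeftAmenableAP : Prop := ∃ m : S.AP →L[ℂ] ℂ, S.IsLeftInvariantMean m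

/-! ### Actions -/

/-- A separately continuous action of `K` on a subset `C` of a locally convex space `E`. The
identity `π(s, π(t, x)) = ∫ π(ζ, x) d(p_s * p_t)(ζ)` is an identity between vectors of `E`; the
vector-valued integral is the weak one, tested by the continuous linear functionals on `E`. -/
structure SepContAction {E : Type*} [AddCommGroup E] [Module ℝ E] [TopologicalSpace E]
    (C : Set E) where
  /-- The map `π : K × C → C`. -/
  act : K → C → C
  act_act : ∀ (s t : K) (x : C) (l : E →L[ℝ] ℝ),
    l (act s (act t x) : E) = ∫ z, l (act z x : E) ∂(S.pconv s t)
  act_identity : ∀ e, S.IsIdentity e → ∀ x, act e x = x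
  continuous_act : ∀ s, Continuous (act s)
  continuous_orbit : ∀ x, Continuous fun s => act s x

variable {S}

/-- The action is non-expansive with respect to every seminorm of the family `Q`. -/
def SepContAction.IsNonexpansive {E : Type*} [AddCommGroup E] [Module ℝ E] [TopologicalSpace E]
    {C : Set E} (π : S.SepContAction C) (Q : Set (Seminorm ℝ E)) : Prop :=
  ∀ p ∈ Q, ∀ (s : K) (x y : C), p ((π.act s x : E) - π.act s y) ≤ p ((x : E) - y)

/-- `x` is a common fixed point of the action. -/
def SepContAction.IsCommonFixedPoint {E : Type*} [AddCommGroup E] [Module ℝ E]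
    [TopologicalSpace E] {C : Set E} (π : S.SepContAction C) (x : C) : Prop :=
  ∀ s, π.act s x = x

end SemitopologicalSemihypergroup
end Semihyper
end

/-! From a mean to a fixed point. Let H be the closed convex hull of the maps `act s` in the product
E^C. Its self-maps of C are non-expansive, hence equicontinuous, so H is compact. The part of H that
composes well is a compact semigroup Γ containing every `act s`. A DeMarr-type minimality argument
(`exists_forall_apply_apply_eq`) gives j in Γ and y in C with j(γ y) = y for all γ in Γ. For a
functional l, the function f(s) = l(π(s, y)) has left translates s ↦ l(π(t, π(s, y))).
Equicontinuity makes f almost periodic, and by affineness and continuity the mean m takes the same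
value on s ↦ l(γ(π(s, y))) for every γ in H (`mean_orbitFunction_eq`). Taking γ = j gives l(y), and
taking γ = `act t` ∘ j gives l(π(t, y)). Hence y is fixed.

From fixed points to a mean. The means on AP(K) form a weak-* compact convex set on which K acts by
adjoints of left translations, and a fixed point is an invariant mean. The remaining point is to
find seminorms for which this action is non-expansive. Those recording |φ(f)| and sup_x |φ(L_x f)|
work, and on means they induce the weak-* topology because orbits in AP(K) are totally bounded.

Both halves use that L_x L_y f is the average of L_ζ f over p_y * p_x. This follows from
associativity once convolution with a point mass is known to be a weak integral over point masses
(`MPlus.integral_map`). -/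

/-! ### Functionals on products and weak barycenters -/

/-- A continuous linear functional on a product depends on finitely many coordinates. -/
theorem exists_finset_eq_sum_single {ι : Type*} {V : ι → Type*} [∀ i, AddCommGroup (V i)]
    [∀ i, Module ℝ (V i)] [∀ i, TopologicalSpace (V i)] [DecidableEq ι]
    (l : (∀ i, V i) →L[ℝ] ℝ) :
    ∃ F : Finset ι, ∀ v, l v = ∑ i ∈ F, l (Pi.single i (v i)) := by
  have hnhds : l ⁻¹' Metric.ball 0 1 ∈ 𝓝 (0 : ∀ i, V i) := by
    refine l.continuous.continuousAt.preimage_mem_nhds ?_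
    rw [map_zero]
    exact Metric.ball_mem_nhds _ one_pos
  rw [nhds_pi, Filter.mem_pi] at hnhds
  obtain ⟨I, hI, t, ht, hsub⟩ := hnhds
  have hzero : ∀ v : ∀ i, V i, (∀ i ∈ I, v i = 0) → l v = 0 := by
    intro v hv
    by_contra hne
    -- The rescaled vector still vanishes on I, so it stays in the basic neighbourhood, although `l`
    -- takes the value 1 on it.
    have hmem : ((l v)⁻¹ • v) ∈ l ⁻¹' Metric.ball 0 1 := by
      refine hsub fun i hi => ?_
      rw [Pi.smul_apply, hv i hi, smul_zero]
      exact mem_of_mem_nhds (ht i)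
    simp [hne] at hmem
  refine ⟨hI.toFinset, fun v => ?_⟩
  rw [← map_sum, ← sub_eq_zero, ← map_sub]
  refine hzero _ fun i hi => ?_
  rw [Pi.sub_apply, Finset.sum_apply, Finset.sum_eq_single i]
  · simp
  · intro j _ hji
    exact Pi.single_eq_of_ne hji.symm _
  · intro h
    exact absurd (hI.mem_toFinset.2 hi) h

/-- A coordinatewise weak integral in a product is a weak integral. -/
theorem apply_eq_integral_of_forall_coord {ι K : Type*} {V : ι → Type*}
    [∀ i, AddCommGroup (V i)] [∀ i, Module ℝ (V i)] [∀ i, TopologicalSpace (V i)]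
    [MeasurableSpace K] {μ : Measure K} {G : K → ∀ i, V i} {w : ∀ i, V i}
    (hint : ∀ i (l : V i →L[ℝ] ℝ), Integrable (fun z => l (G z i)) μ)
    (h : ∀ i (l : V i →L[ℝ] ℝ), l (w i) = ∫ z, l (G z i) ∂μ) (l : (∀ i, V i) →L[ℝ] ℝ) :
    Integrable (fun z => l (G z)) μ ∧ l w = ∫ z, l (G z) ∂μ := by
  classical
  obtain ⟨F, hF⟩ := exists_finset_eq_sum_single l
  rw [hF w]
  simp_rw [fun z => hF (G z)]
  have hc : ∀ i, Continuous fun x : V i => (Pi.single i x : ∀ i, V i) := fun i =>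
    continuous_single i
  let L : ∀ i, V i →L[ℝ] ℝ := fun i => l.comp ⟨LinearMap.single ℝ V i, hc i⟩
  exact ⟨integrable_finsetSum F fun i _ => hint i (L i),
    (Finset.sum_congr rfl fun i _ => h i (L i)).trans
      (integral_finsetSum F fun i _ => hint i (L i)).symm⟩

/-- A weak integral against a probability measure lies in the closed convex hull of the range. -/
theorem mem_closedConvexHull_of_weak_integral {K E : Type*} [AddCommGroup E] [Module ℝ E]
    [TopologicalSpace E] [IsTopologicalAddGroup E] [ContinuousSMul ℝ E] [LocallyConvexSpace ℝ E]
    [MeasurableSpace K] {μ : Measure K} [IsProbabilityMeasure μ] {G : K → E} {w : E}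
    (hint : ∀ l : E →L[ℝ] ℝ, Integrable (fun z => l (G z)) μ)
    (h : ∀ l : E →L[ℝ] ℝ, l w = ∫ z, l (G z) ∂μ) :
    w ∈ closedConvexHull ℝ (Set.range G) := by
  by_contra hw
  obtain ⟨l, c, hl, hc⟩ := geometric_hahn_banach_closed_point
    convex_closedConvexHull isClosed_closedConvexHull hw
  have : ∫ z, l (G z) ∂μ ≤ ∫ _, c ∂μ :=
    integral_mono (hint l) (integrable_const c) fun z =>
      (hl _ (subset_closedConvexHull ⟨z, rfl⟩)).le
  rw [← h l] at this
  simp at this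
  exact absurd hc (not_lt.2 this)

/-- `V` need not be separable, but a compact set containing the range is both bounded and separable.
-/
theorem integrable_of_continuous_of_forall_mem {K V : Type*} [TopologicalSpace K]
    [MeasurableSpace K] [OpensMeasurableSpace K] [NormedAddCommGroup V] (μ : Measure K)
    [IsFiniteMeasure μ] {G : K → V} (hG : Continuous G) {X : Set V} (hX : IsCompact X)
    (hGX : ∀ z, G z ∈ X) : Integrable G μ := by
  obtain ⟨B, hB⟩ := hX.isBounded.exists_norm_le
  refine Integrable.of_bound (StronglyMeasurable.aestronglyMeasurable ?_) B
    (Filter.Eventually.of_forall fun z => hB _ (hGX z))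
  borelize V
  exact stronglyMeasurable_iff_measurable_separable.2 ⟨hG.measurable,
    hX.isSeparable.mono (Set.range_subset_iff.2 hGX)⟩

/-! ### Pointwise and uniform convergence -/

/-- A pointwise continuous family of bounded functions that is uniformly approximated by finitely
many continuous functions is continuous for the supremum norm. -/
theorem continuous_bcf_of_finite_approx {Z X : Type*} [TopologicalSpace Z] [TopologicalSpace X]
    {Ξ : Z → X →ᵇ ℂ}
    (h : ∀ ε > 0, ∃ H : Set (Z → ℂ), H.Finite ∧ (∀ g ∈ H, Continuous g) ∧
      ∀ x, ∃ g ∈ H, ∀ z, dist (Ξ z x) (g z) ≤ ε) : Continuous Ξ := by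
  rw [continuous_iff_continuousAt]
  intro z₀
  rw [ContinuousAt, Metric.tendsto_nhds]
  intro ε hε
  -- Three errors of ε/4 are added: the approximation at z, the one at z₀, and the variation of g;
  -- the last quarter keeps the inequality strict.
  obtain ⟨H, hH, hc, hx⟩ := h (ε / 4) (by positivity)
  have hev : ∀ᶠ z in 𝓝 z₀, ∀ g ∈ H, dist (g z) (g z₀) < ε / 4 :=
    (Filter.eventually_all_finite hH).2 fun g hg =>
      Metric.tendsto_nhds.1 (hc g hg).continuousAt _ (by positivity)
  filter_upwards [hev] with z hz
  refine ((BoundedContinuousFunction.dist_le (C := 3 * (ε / 4)) (by positivity)).2 fun x => ?_).trans_lt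
    (by linarith)
  obtain ⟨g, hg, hgx⟩ := hx x
  have h1 := hgx z
  have h2 := hgx z₀
  have h3 := hz g hg
  rw [dist_comm] at h2
  linarith [dist_triangle4 (Ξ z x) (g z) (g z₀) (Ξ z₀ x)]

/-! ### Compact semigroups of non-expansive maps -/

/-- Minimal non-empty closed sets with a property that is stable under intersections. -/
theorem exists_minimal_isClosed {X : Type*} [TopologicalSpace X] [CompactSpace X]
    (P : Set X → Prop) (hP : ∀ c : Set (Set X), (∀ s ∈ c, P s) → P (⋂₀ c))
    {s₀ : Set X} (hs₀ : IsClosed s₀) (hn : s₀.Nonempty) (hPs : P s₀) :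
    ∃ m ⊆ s₀, IsClosed m ∧ m.Nonempty ∧ P m ∧
      ∀ t ⊆ m, IsClosed t → t.Nonempty → P t → t = m := by
  obtain ⟨m, hms, hm⟩ := zorn_superset_nonempty {s : Set X | IsClosed s ∧ s.Nonempty ∧ P s}
    (fun c hc hchain hne => ⟨⋂₀ c, ⟨isClosed_sInter fun s hs => (hc hs).1, by
        have : Nonempty c := hne.to_subtype
        exact IsCompact.nonempty_sInter_of_directed_nonempty_isCompact_isClosed
          (fun a ha b hb => (hchain.total ha hb).elim (fun h => ⟨a, ha, subset_rfl, h⟩)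
            fun h => ⟨b, hb, h, subset_rfl⟩) (fun s hs => (hc hs).2.1)
          (fun s hs => (hc hs).1.isCompact) (fun s hs => (hc hs).1),
        hP c fun s hs => (hc hs).2.2⟩, fun s hs => Set.sInter_subset_of_mem hs⟩) s₀ ⟨hs₀, hn, hPs⟩
  exact ⟨m, hms, hm.prop.1, hm.prop.2.1, hm.prop.2.2, fun t ht h1 h2 h3 =>
    subset_antisymm ht (hm.le_of_le ⟨h1, h2, h3⟩ ht)⟩

/-- A compact semigroup of continuous maps has a closed right ideal on which left multiplication by
each of its elements is onto. -/
theorem exists_isClosed_right_ideal {X : Type*} [TopologicalSpace X] [CompactSpace X]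
    [T2Space X] {Γ : Set (X → X)}
    (hcl : IsClosed Γ)
    (hne : Γ.Nonempty) (hmul : ∀ f ∈ Γ, ∀ g ∈ Γ, f ∘ g ∈ Γ) (hcont : ∀ f ∈ Γ, Continuous f) :
    ∃ J ⊆ Γ, IsClosed J ∧ J.Nonempty ∧ (∀ j ∈ J, ∀ g ∈ Γ, j ∘ g ∈ J) ∧
      ∀ j ∈ J, ∀ i ∈ J, ∃ i' ∈ J, j ∘ i' = i := by
  obtain ⟨J, hJΓ, hJc, hJn, hJ, hmin⟩ := exists_minimal_isClosed
    (fun s => ∀ j ∈ s, ∀ g ∈ Γ, j ∘ g ∈ s)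
    (fun c hc j hj g hg s hs => hc s hs j (hj s hs) g hg) hcl hne hmul
  refine ⟨J, hJΓ, hJc, hJn, hJ, fun j hj i hi => ?_⟩
  have hleft : Continuous fun g : X → X => j ∘ g :=
    continuous_pi fun x => (hcont j (hJΓ hj)).comp (continuous_apply x)
  -- The set j ∘ J is compact and is again a right ideal inside J, so minimality forces it to be J.
  have himg : (fun g : X → X => j ∘ g) '' J = J := by
    refine hmin _ ?_ (hJc.isCompact.image hleft).isClosed (hJn.image _) ?_
    · rintro _ ⟨g, hg, rfl⟩
      exact hJ j hj g (hJΓ hg)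
    · rintro _ ⟨g, hg, rfl⟩ h hh
      exact ⟨g ∘ h, hJ g hg h hh, rfl⟩
  rw [← himg] at hi
  exact hi

section Nonexpansive

variable {E : Type*} [AddCommGroup E] [Module ℝ E] [TopologicalSpace E]
  {Q : Set (Seminorm ℝ E)} {C : Set E}

/-- A family of maps that are non-expansive for the seminorms is equicontinuous when tested by a
neighbourhood of zero. -/
theorem nonexpansive_eventually_mem (hQ : WithSeminorms (fun p : Q => (p : Seminorm ℝ E)))
    {U : Set E} (hU : U ∈ 𝓝 (0 : E)) (x₀ : C) :
    ∀ᶠ x : C in 𝓝 x₀, ∀ γ : C → C,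
      (∀ p ∈ Q, ∀ x y : C, p ((γ x : E) - γ y) ≤ p ((x : E) - y)) → (γ x : E) - γ x₀ ∈ U := by
  have := hQ.topologicalAddGroup
  obtain ⟨⟨F, r⟩, hr, hsub⟩ := hQ.hasBasis_zero_ball.mem_iff.1 hU
  dsimp only at hr hsub
  rw [Seminorm.ball_finset_sup_eq_iInter _ _ _ hr] at hsub
  have hev : ∀ᶠ x : C in 𝓝 x₀, ∀ p ∈ F, (p : Seminorm ℝ E) ((x : E) - x₀) < r := by
    rw [Filter.eventually_all_finset]
    intro p _
    have hc : Continuous fun x : C => (p : Seminorm ℝ E) ((x : E) - x₀) :=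
      (hQ.continuous_seminorm p).comp (continuous_subtype_val.sub continuous_const)
    refine hc.continuousAt.eventually (gt_mem_nhds ?_)
    simpa using hr
  filter_upwards [hev] with x hx γ hγ
  refine hsub (Set.mem_iInter₂.2 fun p hp => ?_)
  rw [Seminorm.mem_ball_zero]
  exact (hγ p p.2 x x₀).trans_lt (hx p hp)

theorem nonexpansive_continuous (hQ : WithSeminorms (fun p : Q => (p : Seminorm ℝ E)))
    {γ : C → C} (hγ : ∀ p ∈ Q, ∀ x y : C, p ((γ x : E) - γ y) ≤ p ((x : E) - y)) :
    Continuous γ := by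
  have := hQ.topologicalAddGroup
  refine continuous_induced_rng.2 (continuous_iff_continuousAt.2 fun x₀ => ?_)
  rw [ContinuousAt, ← tendsto_sub_nhds_zero_iff]
  exact fun U hU => (nonexpansive_eventually_mem hQ hU x₀).mono fun x hx => hx γ hγ

/-- DeMarr's lemma: a compact set of positive diameter has, in its convex hull, a centre whose
radius is strictly less than the diameter. -/
theorem exists_center_lt_diam [IsTopologicalAddGroup E] {M : Set E} (hM : IsCompact M)
    (hne : M.Nonempty)
    {p : Seminorm ℝ E} (hp : Continuous p) {d : ℝ} (hd : 0 < d)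
    (hdiam : ∀ x ∈ M, ∀ y ∈ M, p (x - y) ≤ d) :
    ∃ u ∈ convexHull ℝ M, ∃ r < d, ∀ y ∈ M, p (u - y) ≤ r := by
  classical
  obtain ⟨t, htM, hcov⟩ := hM.elim_nhds_subcover (fun x => {y | p (x - y) < d / 2}) fun x _ => by
    refine (isOpen_lt (hp.comp (continuous_const.sub continuous_id)) continuous_const).mem_nhds ?_
    simpa using hd
  have htne : t.Nonempty := by
    obtain ⟨x, hx⟩ := hne
    obtain ⟨i, hi, -⟩ := Set.mem_iUnion₂.1 (hcov hx)
    exact ⟨i, hi⟩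
  have hn : (0 : ℝ) < t.card := by exact_mod_cast htne.card_pos
  have hsum : ∑ _i ∈ t, (t.card : ℝ)⁻¹ = 1 := by
    rw [Finset.sum_const, nsmul_eq_mul, mul_inv_cancel₀ hn.ne']
  -- The centre is the barycentre of a finite d/2-net with n points. A point of `M` is within d/2 of
  -- one net point and within d of the others, so averaging gains d/(2n).
  refine ⟨∑ i ∈ t, (t.card : ℝ)⁻¹ • i, ?_, d - (t.card : ℝ)⁻¹ * (d / 2), ?_, fun y hy => ?_⟩
  · exact (convex_convexHull ℝ M).sum_mem (fun _ _ => by positivity) hsum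
      fun i hi => subset_convexHull ℝ M (htM i hi)
  · have : 0 < (t.card : ℝ)⁻¹ * (d / 2) := by positivity
    linarith
  · have e : ∑ i ∈ t, (t.card : ℝ)⁻¹ • i - y = ∑ i ∈ t, (t.card : ℝ)⁻¹ • (i - y) := by
      simp_rw [smul_sub]
      rw [Finset.sum_sub_distrib, ← Finset.sum_smul, hsum, one_smul]
    obtain ⟨j, hj, hjy⟩ := Set.mem_iUnion₂.1 (hcov hy)
    have hjy' : p (j - y) < d / 2 := hjy
    rw [e]
    calc p (∑ i ∈ t, (t.card : ℝ)⁻¹ • (i - y))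
        ≤ ∑ i ∈ t, p ((t.card : ℝ)⁻¹ • (i - y)) := Finset.le_sum_of_subadditive p (map_zero p).le
          (map_add_le_add p) _ _
      _ = ∑ i ∈ t, (t.card : ℝ)⁻¹ * p (i - y) := by
          refine Finset.sum_congr rfl fun i _ => ?_
          rw [map_smul_eq_mul, Real.norm_of_nonneg (by positivity)]
      _ = (t.card : ℝ)⁻¹ * p (j - y) + ∑ i ∈ t.erase j, (t.card : ℝ)⁻¹ * p (i - y) :=
          (Finset.add_sum_erase t (fun i => (t.card : ℝ)⁻¹ * p (i - y)) hj).symm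
      _ ≤ (t.card : ℝ)⁻¹ * (d / 2) + ∑ i ∈ t.erase j, (t.card : ℝ)⁻¹ * d := by
          gcongr with i hi
          exact hdiam i (htM i (Finset.mem_of_mem_erase hi)) y hy
      _ = (t.card : ℝ)⁻¹ * (d / 2) + (∑ i ∈ t, (t.card : ℝ)⁻¹ * d - (t.card : ℝ)⁻¹ * d) := by
          rw [← Finset.add_sum_erase t (fun _ => (t.card : ℝ)⁻¹ * d) hj]
          ring
      _ = d - (t.card : ℝ)⁻¹ * (d / 2) := by
          rw [← Finset.sum_mul, hsum]
          ring

/-- A compact semigroup of non-expansive maps of a compact convex set contains an element `j`,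
and the convex set contains a point `y`, such that `j (γ y) = y` for every `γ` in the semigroup. -/
theorem exists_forall_apply_apply_eq [T2Space E]
    (hQ : WithSeminorms (fun p : Q => (p : Seminorm ℝ E))) (hC : IsCompact C)
    (hconv : Convex ℝ C) (hCne : C.Nonempty) {Γ : Set (C → C)} (hcl : IsClosed Γ)
    (hne : Γ.Nonempty) (hmul : ∀ f ∈ Γ, ∀ g ∈ Γ, f ∘ g ∈ Γ)
    (hexp : ∀ f ∈ Γ, ∀ p ∈ Q, ∀ x y : C, p ((f x : E) - f y) ≤ p ((x : E) - y)) :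
    ∃ j ∈ Γ, ∃ y : C, ∀ γ ∈ Γ, j (γ y) = y := by
  have := hQ.topologicalAddGroup
  have := hQ.continuousSMul
  have hcomp : CompactSpace C := isCompact_iff_compactSpace.1 hC
  have hCn : Nonempty C := hCne.to_subtype
  obtain ⟨J, hJΓ, hJc, ⟨j₀, hj₀⟩, hJ, hJJ⟩ := exists_isClosed_right_ideal hcl hne hmul
    fun f hf => nonexpansive_continuous hQ (hexp f hf)
  -- D is minimal among non-empty closed convex J-invariant sets. Convexity is spelled out in `E`
  -- because D lives in the subtype `C`.
  obtain ⟨D, -, hDc, ⟨x, hx⟩, ⟨hDconv, hDJ⟩, hmin⟩ := exists_minimal_isClosed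
    (fun s : Set C => (∀ x ∈ s, ∀ y ∈ s, ∀ a b : ℝ, 0 ≤ a → 0 ≤ b → a + b = 1 → ∀ z : C,
      (z : E) = a • (x : E) + b • (y : E) → z ∈ s) ∧ ∀ j ∈ J, ∀ x ∈ s, j x ∈ s)
    (fun c hc => ⟨fun x hx y hy a b ha hb hab z hz s hs =>
        (hc s hs).1 x (hx s hs) y (hy s hs) a b ha hb hab z hz,
      fun j hj x hx s hs => (hc s hs).2 j hj x (hx s hs)⟩)
    isClosed_univ Set.univ_nonempty ⟨fun _ _ _ _ _ _ _ _ _ _ _ => trivial, fun _ _ _ _ => trivial⟩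
  set M : Set C := (fun j : C → C => j x) '' J with hM
  have hMc : IsCompact M := hJc.isCompact.image (continuous_apply x)
  have hMD : M ⊆ D := by
    rintro _ ⟨j, hj, rfl⟩
    exact hDJ j hj x hx
  -- Since j ∘ J = J, each j in J maps the orbit M onto itself.
  have hMj : ∀ j ∈ J, ∀ y ∈ M, ∃ y' ∈ M, j y' = y := by
    rintro j hj _ ⟨i, hi, rfl⟩
    obtain ⟨i', hi', e⟩ := hJJ j hj i hi
    exact ⟨i' x, ⟨i', hi', rfl⟩, congrFun e x⟩
  have hzero : ∀ p ∈ Q, ∀ y ∈ M, ∀ z ∈ M, p ((y : E) - z) = 0 := by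
    intro p hpQ
    have hp : Continuous p := hQ.continuous_seminorm ⟨p, hpQ⟩
    have hpc : Continuous fun q : C × C => p ((q.1 : E) - q.2) :=
      hp.comp ((continuous_subtype_val.comp continuous_fst).sub
        (continuous_subtype_val.comp continuous_snd))
    obtain ⟨⟨y₀, z₀⟩, ⟨hy₀, hz₀⟩, hmax⟩ := (hMc.prod hMc).exists_isMaxOn
      ⟨(j₀ x, j₀ x), ⟨j₀, hj₀, rfl⟩, ⟨j₀, hj₀, rfl⟩⟩ hpc.continuousOn
    have hmax' : ∀ y ∈ M, ∀ z ∈ M, p ((y : E) - z) ≤ p ((y₀ : E) - z₀) :=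
      fun y hy z hz => hmax (Set.mk_mem_prod hy hz)
    by_contra hcon
    have hd : 0 < p ((y₀ : E) - z₀) := by
      push Not at hcon
      obtain ⟨y, hy, z, hz, hyz⟩ := hcon
      exact (lt_of_le_of_ne (apply_nonneg p _) hyz.symm).trans_le (hmax' y hy z hz)
    obtain ⟨w, hw, r, hr, hwr⟩ := exists_center_lt_diam (hMc.image continuous_subtype_val)
      ⟨y₀, y₀, hy₀, rfl⟩ hp hd (by
        rintro _ ⟨y, hy, rfl⟩ _ ⟨z, hz, rfl⟩
        exact hmax' y hy z hz)
    have hDE : Convex ℝ (Subtype.val '' D : Set E) := by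
      rintro _ ⟨a, ha, rfl⟩ _ ⟨b, hb, rfl⟩ s t hs ht hst
      exact ⟨⟨_, hconv a.2 b.2 hs ht hst⟩, hDconv a ha b hb s t hs ht hst _ rfl, rfl⟩
    obtain ⟨w', hw'D, rfl⟩ := convexHull_min (Set.image_mono hMD) hDE hw
    -- The points of D within r of all of M form a J-invariant set, since every y in M is some j y'
    -- and j is non-expansive. Minimality makes this set D, although y₀ in D is at distance greater
    -- than r from z₀.
    have hD' := hmin {z ∈ D | ∀ y ∈ M, p ((z : E) - y) ≤ r} (Set.sep_subset _ _) ?_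
      ⟨w', hw'D, fun y hy => hwr y ⟨y, hy, rfl⟩⟩ ⟨?_, ?_⟩
    · have h1 := hMD hy₀
      rw [← hD'] at h1
      exact absurd (h1.2 z₀ hz₀) (not_le.2 hr)
    · have hball : IsClosed (⋂ y ∈ M, {z : C | p ((z : E) - y) ≤ r}) :=
        isClosed_biInter fun y _ =>
          isClosed_le (hp.comp (continuous_subtype_val.sub continuous_const)) continuous_const
      convert hDc.inter hball using 1
      ext z
      simp
    · rintro a ⟨ha, ha'⟩ b ⟨hb, hb'⟩ s t hs ht hst z hz
      refine ⟨hDconv a ha b hb s t hs ht hst z hz, fun y hy => ?_⟩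
      have e : (z : E) - y = s • ((a : E) - y) + t • ((b : E) - y) := by
        rw [hz, smul_sub, smul_sub, sub_add_sub_comm, ← add_smul, hst, one_smul]
      rw [e]
      refine (map_add_le_add p _ _).trans ?_
      rw [map_smul_eq_mul, map_smul_eq_mul, Real.norm_of_nonneg hs, Real.norm_of_nonneg ht]
      calc s * p ((a : E) - y) + t * p ((b : E) - y) ≤ s * r + t * r := by
            gcongr
            · exact ha' y hy
            · exact hb' y hy
        _ = r := by rw [← add_mul, hst, one_mul]
    · rintro j hj z ⟨hz, hz'⟩
      refine ⟨hDJ j hj z hz, fun y hy => ?_⟩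
      obtain ⟨y', hy', rfl⟩ := hMj j hj y hy
      exact (hexp j (hJΓ hj) p hpQ z y').trans (hz' y' hy')
  have hsub : ∀ y ∈ M, ∀ z ∈ M, y = z := by
    intro y hy z hz
    by_contra hne
    obtain ⟨p, hp⟩ := hQ.separating_of_T1 ((y : E) - z)
      (sub_ne_zero.2 fun h => hne (Subtype.ext h))
    exact hp (hzero p p.2 y hy z hz)
  -- M is the single point y = j₀ x, and j₀ ∘ γ ∘ j₀ lies in the right ideal J, so it also sends x
  -- to y.
  refine ⟨j₀, hJΓ hj₀, j₀ x, fun γ hγ => hsub _ ⟨j₀ ∘ γ ∘ j₀, ?_, rfl⟩ _ ⟨j₀, hj₀, rfl⟩⟩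
  exact hJ j₀ hj₀ _ (hmul γ hγ j₀ (hJΓ hj₀))

end Nonexpansive

/-! ### Convolution of measures as a weak integral over point masses -/

noncomputable section

namespace Semihyper

set_option linter.unusedSectionVars false

variable {K : Type*} [TopologicalSpace K] [MeasurableSpace K] [BorelSpace K] [T2Space K]

namespace MPlus

theorem toM_apply (μ : MPlus K) {A : Set K} (hA : MeasurableSet A) :
    (μ.toM : ComplexMeasure K) A = ((μ.meas.real A : ℝ) : ℂ) := by
  change (μ.meas.toSignedMeasure.toComplexMeasure 0) A = _
  rw [SignedMeasure.toComplexMeasure_apply, Measure.toSignedMeasure_apply_measurable hA]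
  rfl

/-- Brings linearity and associativity of the convolution, which are given in `M K`, back to `MPlus
K`. -/
theorem toM_injective : Function.Injective (toM : MPlus K → M K) := by
  intro μ ν h
  refine Subtype.ext (Measure.ext fun A hA => ?_)
  have h1 := congrArg (fun c : M K => (c : ComplexMeasure K) A) h
  simp only [toM_apply _ hA, Complex.ofReal_inj] at h1
  exact (measureReal_eq_measureReal_iff (measure_ne_top μ.meas _) (measure_ne_top ν.meas _)).1 h1

/-- The combination `a μ + b ν` of two elements of `M⁺(K)`. -/
def comb (a b : ℝ≥0) (μ ν : MPlus K) : MPlus K :=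
  ⟨a • μ.meas + b • ν.meas, inferInstance, by
    have : (a • μ.meas + b • ν.meas).InnerRegular := by
      have h1 : ((a : ℝ≥0∞) • μ.meas).InnerRegular := inferInstance
      have h2 : ((b : ℝ≥0∞) • ν.meas).InnerRegular := inferInstance
      change ((a : ℝ≥0∞) • μ.meas + (b : ℝ≥0∞) • ν.meas).InnerRegular
      infer_instance
    infer_instance⟩

theorem comb_meas (a b : ℝ≥0) (μ ν : MPlus K) :
    (comb a b μ ν).meas = a • μ.meas + b • ν.meas := rfl

theorem toM_comb (a b : ℝ≥0) (μ ν : MPlus K) :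
    (comb a b μ ν).toM = ((a : ℝ) : ℂ) • μ.toM + ((b : ℝ) : ℂ) • ν.toM := by
  refine Subtype.ext (VectorMeasure.ext fun A hA => ?_)
  rw [toM_apply _ hA, comb_meas]
  change _ = ((a : ℝ) : ℂ) • (μ.toM : ComplexMeasure K) A
    + ((b : ℝ) : ℂ) • (ν.toM : ComplexMeasure K) A
  rw [toM_apply _ hA, toM_apply _ hA, measureReal_add_apply]
  simp [measureReal_nnreal_smul_apply]

theorem integral_comb {F : Type*} [NormedAddCommGroup F] [NormedSpace ℝ F] (a b : ℝ≥0)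
    (μ ν : MPlus K) {f : K → F}
    (hμ : Integrable f μ.meas) (hν : Integrable f ν.meas) :
    ∫ x, f x ∂(comb a b μ ν).meas = (a : ℝ) • ∫ x, f x ∂μ.meas + (b : ℝ) • ∫ x, f x ∂ν.meas := by
  rw [comb_meas, integral_add_measure hμ.smul_measure_nnreal hν.smul_measure_nnreal,
    integral_smul_nnreal_measure, integral_smul_nnreal_measure]
  rfl

theorem real_univ_comb (a b : ℝ≥0) (μ ν : MPlus K) :
    (comb a b μ ν).meas.real Set.univ
      = a * μ.meas.real Set.univ + b * ν.meas.real Set.univ := by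
  rw [comb_meas, measureReal_add_apply]
  simp [measureReal_nnreal_smul_apply]

theorem continuous_real_univ : Continuous fun μ : MPlus K => μ.meas.real Set.univ :=
  continuous_snd.comp (continuous_induced_dom (f := fun μ : MPlus K =>
    ((fun f : C_c(K, ℝ≥0) => ∫ x, (f x : ℝ) ∂μ.meas), μ.meas.real Set.univ)))

theorem isProbabilityMeasure_meas_iff (μ : MPlus K) :
    IsProbabilityMeasure μ.meas ↔ μ.meas.real Set.univ = 1 := by
  rw [isProbabilityMeasure_iff, measureReal_def, ENNReal.toReal_eq_one_iff]

theorem map_comb_of_linear {T : MPlus K → MPlus K} {A : M K →ₗ[ℂ] M K}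
    (hA : ∀ μ, (T μ).toM = A μ.toM) (a b : ℝ≥0) (μ ν : MPlus K) :
    T (comb a b μ ν) = comb a b (T μ) (T ν) := by
  refine toM_injective ?_
  rw [hA, toM_comb, toM_comb, map_add, map_smul, map_smul, hA, hA]

variable [LocallyCompactSpace K]

instance (x : K) : IsProbabilityMeasure (point x).meas :=
  inferInstanceAs (IsProbabilityMeasure (Measure.dirac x))

/-- Every probability measure is, in the cone topology, a limit of convex combinations of point
masses. -/
theorem mem_closure_of_point_mem {P : Set (MPlus K)} (hpt : ∀ x, point x ∈ P)
    (hcomb : ∀ μ ∈ P, ∀ ν ∈ P, ∀ a b : ℝ≥0, a + b = 1 → comb a b μ ν ∈ P)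
    (μ : MPlus K) [IsProbabilityMeasure μ.meas] : μ ∈ closure P := by
  rw [closure_induced]
  set Φ : MPlus K → (C_c(K, ℝ≥0) → ℝ) × ℝ :=
    fun μ => ((fun f : C_c(K, ℝ≥0) => ∫ x, (f x : ℝ) ∂μ.meas), μ.meas.real Set.univ) with hΦ
  have hfint : ∀ (f : C_c(K, ℝ≥0)) (ν : MPlus K), Integrable (fun x => (f x : ℝ)) ν.meas :=
    fun f ν => by
      have hf : HasCompactSupport fun x => (f x : ℝ) :=
        f.hasCompactSupport.comp_left (g := fun r : ℝ≥0 => (r : ℝ)) rfl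
      exact (show Continuous fun x => (f x : ℝ) by fun_prop).integrable_of_hasCompactSupport hf
  have hpoint : ∀ (f : C_c(K, ℝ≥0)) (z : K), ∫ x, (f x : ℝ) ∂(point z).meas = f z :=
    fun f z => integral_dirac _ _
  have hone : ∀ (l : ℝ →L[ℝ] ℝ) (r : ℝ), l r = r * l 1 := fun l r => by
    rw [← smul_eq_mul, ← map_smul, smul_eq_mul, mul_one]
  have hcoord : ∀ (f : C_c(K, ℝ≥0)) (l : ℝ →L[ℝ] ℝ),
      (fun z => l (∫ x, (f x : ℝ) ∂(point z).meas)) = fun z => (f z : ℝ) * l 1 :=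
    fun f l => funext fun z => by rw [hpoint, hone l (f z)]
  have hcoordi : ∀ (f : C_c(K, ℝ≥0)) (l : ℝ →L[ℝ] ℝ),
      Integrable (fun z => l (∫ x, (f x : ℝ) ∂(point z).meas)) μ.meas := fun f l => by
    rw [hcoord f l]
    exact (hfint f μ).mul_const _
  have hweak : ∀ l : (C_c(K, ℝ≥0) → ℝ) × ℝ →L[ℝ] ℝ,
      Integrable (fun z => l (Φ (point z))) μ.meas ∧
        l (Φ μ) = ∫ z, l (Φ (point z)) ∂μ.meas := by
    intro l
    set l₁ := l.comp (ContinuousLinearMap.inl ℝ (C_c(K, ℝ≥0) → ℝ) ℝ)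
    -- All measures involved have mass 1, so the last coordinate contributes only a constant,
    -- leaving a functional on a pure product.
    have hl : ∀ ν : MPlus K, ν.meas.real Set.univ = 1 →
        l (Φ ν) = l₁ (Φ ν).1 + l (0, 1) := by
      intro ν hν
      have : Φ ν = ((Φ ν).1, 0) + (0, 1) := by
        simp [hΦ, hν]
      rw [this, map_add]
      simp [l₁]
    have hpu : ∀ z : K, (point z).meas.real Set.univ = 1 := fun z => probReal_univ
    obtain ⟨hi₁, hl₁⟩ := apply_eq_integral_of_forall_coord (μ := μ.meas) (G := fun z => (Φ (point z)).1)
      (w := (Φ μ).1) (fun f l => hcoordi f l) (fun f l => by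
        change l (∫ x, (f x : ℝ) ∂μ.meas) = ∫ z, l (∫ x, (f x : ℝ) ∂(point z).meas) ∂μ.meas
        rw [hcoord f l, integral_mul_const, ← hone]) l₁
    simp_rw [fun z => hl (point z) (hpu z)]
    refine ⟨hi₁.add (integrable_const _), ?_⟩
    rw [hl μ probReal_univ, integral_add hi₁ (integrable_const _), ← hl₁]
    simp
  have hmem : Φ μ ∈ closedConvexHull ℝ (Set.range fun z => Φ (point z)) :=
    mem_closedConvexHull_of_weak_integral (fun l => (hweak l).1) fun l => (hweak l).2
  refine closedConvexHull_min ?_ (Convex.closure ?_) isClosed_closure hmem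
  · rintro _ ⟨z, rfl⟩
    exact subset_closure ⟨_, hpt z, rfl⟩
  · rintro _ ⟨ν₁, h₁, rfl⟩ _ ⟨ν₂, h₂, rfl⟩ a b ha hb hab
    lift a to ℝ≥0 using ha
    lift b to ℝ≥0 using hb
    refine ⟨comb a b ν₁ ν₂, hcomb _ h₁ _ h₂ a b (by exact_mod_cast hab), ?_⟩
    refine Prod.ext (funext fun f => ?_) ?_
    · exact integral_comb a b ν₁ ν₂ (hfint f ν₁) (hfint f ν₂)
    · exact real_univ_comb a b ν₁ ν₂

variable {T : MPlus K → MPlus K} {A : M K →ₗ[ℂ] M K}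

/-- Having an image of mass 1 is a closed condition stable under convex combinations, so it spreads
from point masses by density. -/
theorem isProbabilityMeasure_map (hT : Continuous T) (hA : ∀ μ, (T μ).toM = A μ.toM)
    (hp : ∀ x, IsProbabilityMeasure (T (point x)).meas) (μ : MPlus K)
    [IsProbabilityMeasure μ.meas] : IsProbabilityMeasure (T μ).meas := by
  have hcl : IsClosed {ν : MPlus K | (T ν).meas.real Set.univ = 1} :=
    isClosed_eq (continuous_real_univ.comp hT) continuous_const
  rw [isProbabilityMeasure_meas_iff]
  refine closure_minimal subset_rfl hcl (mem_closure_of_point_mem (fun x => ?_) ?_ μ)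
  · exact (isProbabilityMeasure_meas_iff _).1 (hp x)
  · intro μ hμ ν hν a b hab
    simp only [Set.mem_ofPred_eq] at hμ hν ⊢
    rw [map_comb_of_linear hA, real_univ_comb, hμ, hν, mul_one, mul_one]
    exact_mod_cast hab

/-- A positive continuous linear operation on measures is an integral of its values at point
masses. -/
theorem integral_map (hT : Continuous T) (hA : ∀ μ, (T μ).toM = A μ.toM)
    (hp : ∀ x, IsProbabilityMeasure (T (point x)).meas) (f : K →ᵇ ℂ) (μ : MPlus K)
    [IsProbabilityMeasure μ.meas] :
    ∫ x, f x ∂(T μ).meas = ∫ y, ∫ x, f x ∂(T (point y)).meas ∂μ.meas := by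
  let g : K →ᵇ ℂ := BoundedContinuousFunction.ofNormedAddCommGroup
    (fun y => ∫ x, f x ∂(T (point y)).meas)
    (continuous_integral_complex (hT.comp continuous_point) hp f) ‖f‖ fun y => by
      refine (norm_integral_le_of_norm_le_const (μ := (T (point y)).meas)
        (Filter.Eventually.of_forall fun z => f.norm_coe_le_norm z)).trans ?_
      simp
  let Y := {ν : MPlus K // IsProbabilityMeasure ν.meas}
  have hY : ∀ ν : Y, IsProbabilityMeasure ν.1.meas := fun ν => ν.2
  have c₁ : Continuous fun ν : Y => ∫ x, f x ∂(T ν.1).meas :=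
    continuous_integral_complex (hT.comp continuous_subtype_val)
      (fun ν => isProbabilityMeasure_map hT hA hp ν.1) f
  have c₂ : Continuous fun ν : Y => ∫ x, g x ∂ν.1.meas :=
    continuous_integral_complex continuous_subtype_val hY g
  have hcl : IsClosed {ν : Y | ∫ x, f x ∂(T ν.1).meas = ∫ x, g x ∂ν.1.meas} :=
    isClosed_eq c₁ c₂
  let P : Set (MPlus K) :=
    Subtype.val '' {ν : Y | ∫ x, f x ∂(T ν.1).meas = ∫ x, g x ∂ν.1.meas}
  have hμ : μ ∈ closure P := by
    refine mem_closure_of_point_mem (P := P) (fun x => ⟨⟨point x, inferInstance⟩, ?_, rfl⟩) ?_ μ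
    · exact (integral_dirac (fun x => g x) x).symm
    · rintro _ ⟨ν₁, h₁, rfl⟩ _ ⟨ν₂, h₂, rfl⟩ a b hab
      have hpr : IsProbabilityMeasure (comb a b ν₁.1 ν₂.1).meas := by
        rw [isProbabilityMeasure_meas_iff, real_univ_comb, (isProbabilityMeasure_meas_iff _).1 ν₁.2,
          (isProbabilityMeasure_meas_iff _).1 ν₂.2, mul_one, mul_one]
        exact_mod_cast hab
      refine ⟨⟨_, hpr⟩, ?_, rfl⟩
      change ∫ x, f x ∂(T ν₁.1).meas = ∫ x, g x ∂ν₁.1.meas at h₁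
      change ∫ x, f x ∂(T ν₂.1).meas = ∫ x, g x ∂ν₂.1.meas at h₂
      change ∫ x, f x ∂(T (comb a b ν₁.1 ν₂.1)).meas = ∫ x, g x ∂(comb a b ν₁.1 ν₂.1).meas
      rw [map_comb_of_linear hA, integral_comb _ _ _ _ (f.integrable _) (f.integrable _),
        integral_comb _ _ _ _ (g.integrable _) (g.integrable _), h₁, h₂]
  have hμY : (⟨μ, inferInstance⟩ : Y) ∈
      closure {ν : Y | ∫ x, f x ∂(T ν.1).meas = ∫ x, g x ∂ν.1.meas} := by
    rw [closure_subtype]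
    exact hμ
  exact hcl.closure_subset hμY

end MPlus

namespace SemitopologicalSemihypergroup

variable [LocallyCompactSpace K] (S : SemitopologicalSemihypergroup K)

theorem integral_conv_left (x : K) (μ : MPlus K) [IsProbabilityMeasure μ.meas] (f : K →ᵇ ℂ) :
    ∫ z, f z ∂(S.convPlus (MPlus.point x) μ).meas = ∫ y, ∫ z, f z ∂(S.pconv x y) ∂μ.meas :=
  MPlus.integral_map (A := S.conv (MPlus.point x).toM)
    (S.continuous_convPlus_left _) (fun _ => S.toM_convPlus _ _)
    (fun y => S.isProbabilityMeasure_point x y) f μ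

theorem integral_conv_right (y : K) (μ : MPlus K) [IsProbabilityMeasure μ.meas] (f : K →ᵇ ℂ) :
    ∫ z, f z ∂(S.convPlus μ (MPlus.point y)).meas = ∫ x, ∫ z, f z ∂(S.pconv x y) ∂μ.meas :=
  MPlus.integral_map (A := S.conv.flip (MPlus.point y).toM)
    (S.continuous_convPlus_right _) (fun _ => S.toM_convPlus _ _)
    (fun x => S.isProbabilityMeasure_point x y) f μ

theorem convPlus_assoc (μ ν ω : MPlus K) :
    S.convPlus (S.convPlus μ ν) ω = S.convPlus μ (S.convPlus ν ω) := by
  refine MPlus.toM_injective ?_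
  rw [S.toM_convPlus, S.toM_convPlus, S.toM_convPlus, S.toM_convPlus, S.conv_assoc]

/-- Composition of left translations: `L_x L_y f = ∫ L_ζ f d(p_y * p_x)(ζ)` pointwise. -/
theorem leftTranslate_leftTranslate_apply (x y z : K) (f : K →ᵇ ℂ) :
    S.leftTranslate x (S.leftTranslate y f) z
      = ∫ ζ, S.leftTranslate ζ f z ∂(S.pconv y x) := by
  have h₁ : IsProbabilityMeasure (S.convPlus (MPlus.point x) (MPlus.point z)).meas :=
    S.isProbabilityMeasure_point x z
  have h₂ : IsProbabilityMeasure (S.convPlus (MPlus.point y) (MPlus.point x)).meas :=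
    S.isProbabilityMeasure_point y x
  -- Both sides integrate f against p_y * p_x * p_z, expanded once over the right factor p_x * p_z
  -- and once over the left factor p_y * p_x.
  have e₁ := S.integral_conv_left y (S.convPlus (MPlus.point x) (MPlus.point z)) f
  have e₂ := S.integral_conv_right z (S.convPlus (MPlus.point y) (MPlus.point x)) f
  rw [S.convPlus_assoc] at e₂
  exact e₁.symm.trans e₂

theorem leftTranslate_identity {e : K} (he : S.IsIdentity e) (f : K →ᵇ ℂ) :
    S.leftTranslate e f = f := by
  ext y
  rw [leftTranslate_apply, (he y).2, integral_dirac]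

theorem norm_leftTranslate_le (x : K) (f : K →ᵇ ℂ) : ‖S.leftTranslate x f‖ ≤ ‖f‖ :=
  (BoundedContinuousFunction.norm_le (norm_nonneg f)).2 fun y => by
    rw [leftTranslate_apply]
    refine (norm_integral_le_of_norm_le_const (μ := S.pconv x y)
      (Filter.Eventually.of_forall fun z => f.norm_coe_le_norm z)).trans ?_
    simp

theorem continuous_leftTranslate_apply (f : K →ᵇ ℂ) (y : K) :
    Continuous fun x => S.leftTranslate x f y :=
  continuous_integral_complex ((S.continuous_convPlus_right (MPlus.point y)).comp
    MPlus.continuous_point) (fun x => S.isProbabilityMeasure_point x y) f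

end SemitopologicalSemihypergroup
end Semihyper
end

/-! ### Norm continuity of orbits and translation invariance of AP(K) -/

noncomputable section

namespace Semihyper
namespace SemitopologicalSemihypergroup

variable {K : Type*} [TopologicalSpace K] [MeasurableSpace K] [BorelSpace K] [T2Space K]
  [LocallyCompactSpace K] (S : SemitopologicalSemihypergroup K)

variable {S} in
/-- The orbit of an almost periodic function depends continuously on the translating element. -/
theorem continuous_leftTranslate {f : K →ᵇ ℂ} (hf : f ∈ S.AP) :
    Continuous fun x => S.leftTranslate x f := by
  set X := closure (Set.range fun x => S.leftTranslate x f)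
  have : CompactSpace X := isCompact_iff_compactSpace.1 hf
  -- On the norm-compact orbit closure the coarser Hausdorff topology of pointwise convergence
  -- agrees with the norm topology.
  have hemb : IsClosedEmbedding fun (g : X) (y : K) => (g : K →ᵇ ℂ) y := by
    refine Continuous.isClosedEmbedding (continuous_pi fun y => ?_) fun g h e => ?_
    · exact (continuous_eval_const y).comp continuous_subtype_val
    · exact Subtype.ext (DFunLike.coe_injective e)
  have hX : Continuous fun x => (⟨S.leftTranslate x f, subset_closure ⟨x, rfl⟩⟩ : X) := by
    rw [hemb.isInducing.continuous_iff]
    exact continuous_pi fun y => S.continuous_leftTranslate_apply f y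
  exact continuous_subtype_val.comp hX

variable {S} in
theorem integrable_leftTranslate {f : K →ᵇ ℂ} (hf : f ∈ S.AP) (μ : Measure K)
    [IsFiniteMeasure μ] : Integrable (fun x => S.leftTranslate x f) μ :=
  integrable_of_continuous_of_forall_mem μ (continuous_leftTranslate hf) hf
    fun x => subset_closure ⟨x, rfl⟩

variable {S} in
theorem leftTranslate_leftTranslate {f : K →ᵇ ℂ} (hf : f ∈ S.AP) (x y : K) :
    S.leftTranslate x (S.leftTranslate y f) = ∫ ζ, S.leftTranslate ζ f ∂(S.pconv y x) := by
  ext z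
  rw [S.leftTranslate_leftTranslate_apply]
  exact (BoundedContinuousFunction.evalCLM ℂ z).integral_comp_comm
    (integrable_leftTranslate hf (S.pconv y x))

-- Each L_x L_y f is an average of the orbit of f, so the orbit of L_y f stays in the closed convex
-- hull of that orbit, which is compact by completeness.
variable {S} in
theorem leftTranslate_mem_AP {f : K →ᵇ ℂ} (hf : f ∈ S.AP) (y : K) :
    S.leftTranslate y f ∈ S.AP := by
  have htb : TotallyBounded (convexHull ℝ (Set.range fun x => S.leftTranslate x f)) :=
    ((IsCompact.totallyBounded hf).subset subset_closure).convexHull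
  have hc : IsCompact (closedConvexHull ℝ (Set.range fun x => S.leftTranslate x f)) := by
    rw [closedConvexHull_eq_closure_convexHull]
    exact htb.closure.isCompact_of_isClosed isClosed_closure
  refine hc.of_isClosed_subset isClosed_closure (closure_minimal ?_ hc.isClosed)
  rintro _ ⟨x, rfl⟩
  change S.leftTranslate x (S.leftTranslate y f) ∈ _
  rw [leftTranslate_leftTranslate hf]
  exact Convex.integral_mem convex_closedConvexHull isClosed_closedConvexHull
    (Filter.Eventually.of_forall fun ζ => subset_closedConvexHull ⟨ζ, rfl⟩)
    (integrable_leftTranslate hf (S.pconv y x))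

end SemitopologicalSemihypergroup
end Semihyper
end

/-! ### From an invariant mean to a common fixed point -/

noncomputable section

namespace Semihyper
namespace SemitopologicalSemihypergroup
namespace SepContAction

set_option linter.unusedSectionVars false

variable {K : Type*} [TopologicalSpace K] [MeasurableSpace K] [BorelSpace K] [T2Space K]
  [LocallyCompactSpace K] {S : SemitopologicalSemihypergroup K}
  {E : Type*} [AddCommGroup E] [Module ℝ E] [TopologicalSpace E]
  [IsTopologicalAddGroup E] [ContinuousSMul ℝ E]
  {Q : Set (Seminorm ℝ E)} {C : Set E} (π : S.SepContAction C)

/-- The maps of `C` into itself that belong to the closed convex hull of the maps `act s` in the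
topology of pointwise convergence. -/
def hullMaps : Set (C → C) :=
  {γ | (fun c => (γ c : E)) ∈ closedConvexHull ℝ (Set.range fun s c => (π.act s c : E))}

theorem continuous_coe_maps : Continuous fun (γ : C → C) (c : C) => (γ c : E) :=
  continuous_pi fun c => continuous_subtype_val.comp (continuous_apply c)

theorem isClosed_hullMaps : IsClosed π.hullMaps :=
  isClosed_closedConvexHull.preimage continuous_coe_maps

theorem act_mem_hullMaps (s : K) : π.act s ∈ π.hullMaps :=
  subset_closedConvexHull ⟨s, rfl⟩

theorem nonexpansive_of_mem_hullMaps (hQ : WithSeminorms (fun p : Q => (p : Seminorm ℝ E)))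
    (hπ : π.IsNonexpansive Q) {γ : C → C} (hγ : γ ∈ π.hullMaps) :
    ∀ p ∈ Q, ∀ x y : C, p ((γ x : E) - γ y) ≤ p ((x : E) - y) := by
  intro p hp x y
  have hpc : Continuous p := hQ.continuous_seminorm ⟨p, hp⟩
  refine closedConvexHull_min (t := {g : C → E | p (g x - g y) ≤ p ((x : E) - y)}) ?_ ?_ ?_ hγ
  · rintro _ ⟨s, rfl⟩
    exact hπ p hp s x y
  · intro f hf g hg a b ha hb hab
    have e : (a • f + b • g) x - (a • f + b • g) y = a • (f x - f y) + b • (g x - g y) := by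
      simp only [Pi.add_apply, Pi.smul_apply, smul_sub]
      abel
    change p ((a • f + b • g) x - (a • f + b • g) y) ≤ _
    rw [e]
    refine (map_add_le_add p _ _).trans ?_
    rw [map_smul_eq_mul, map_smul_eq_mul, Real.norm_of_nonneg ha, Real.norm_of_nonneg hb]
    calc a * p (f x - f y) + b * p (g x - g y)
        ≤ a * p ((x : E) - y) + b * p ((x : E) - y) := by
          gcongr
          · exact hf
          · exact hg
      _ = p ((x : E) - y) := by rw [← add_mul, hab, one_mul]
  · exact isClosed_le (hpc.comp ((continuous_apply x).sub (continuous_apply y))) continuous_const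

theorem integrable_apply_act (hC : IsCompact C) (μ : Measure K) [IsFiniteMeasure μ] (x : C)
    (l : E →L[ℝ] ℝ) : Integrable (fun z => l (π.act z x : E)) μ := by
  have : CompactSpace C := isCompact_iff_compactSpace.1 hC
  have hl : Continuous fun c : C => l (c : E) := l.continuous.comp continuous_subtype_val
  exact ((mkOfCompact ⟨_, hl⟩).compContinuous ⟨_, π.continuous_orbit x⟩).integrable μ

/-- Composition on the right with `act t` is linear and continuous on E^C, which reduces the claim
to γ = `act s`; there `act s ∘ act t` is a weak integral of the maps `act z`. -/
theorem comp_act_mem_hullMaps [LocallyConvexSpace ℝ E] (hC : IsCompact C) {γ : C → C}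
    (hγ : γ ∈ π.hullMaps) (t : K) :
    γ ∘ π.act t ∈ π.hullMaps := by
  let R : (C → E) →L[ℝ] (C → E) :=
    ⟨LinearMap.funLeft ℝ E (π.act t), continuous_pi fun c => continuous_apply (π.act t c)⟩
  refine closedConvexHull_min (t := R ⁻¹' closedConvexHull ℝ
    (Set.range fun s c => (π.act s c : E))) ?_
    (convex_closedConvexHull.is_linear_preimage R.toLinearMap.isLinear)
    (isClosed_closedConvexHull.preimage R.continuous) hγ
  rintro _ ⟨s, rfl⟩
  have h := apply_eq_integral_of_forall_coord (μ := S.pconv s t)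
    (G := fun z (c : C) => (π.act z c : E)) (w := fun c => (π.act s (π.act t c) : E))
    (fun c l => π.integrable_apply_act hC _ c l) (fun c l => π.act_act s t c l)
  exact mem_closedConvexHull_of_weak_integral (fun l => (h l).1) fun l => (h l).2

/-- The bounded continuous function `s ↦ l (γ (π(s, x)))`. -/
def orbitFunction [CompactSpace C] (x : C) (l : E →L[ℝ] ℝ) {γ : C → C} (hγ : Continuous γ) :
    K →ᵇ ℂ :=
  (mkOfCompact ⟨fun c : C => ((l (γ c : E) : ℝ) : ℂ), Complex.continuous_ofReal.comp
    (l.continuous.comp (continuous_subtype_val.comp hγ))⟩).compContinuous ⟨_, π.continuous_orbit x⟩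

theorem orbitFunction_apply [CompactSpace C] (x : C) (l : E →L[ℝ] ℝ) {γ : C → C}
    (hγ : Continuous γ) (s : K) :
    π.orbitFunction x l hγ s = ((l (γ (π.act s x) : E) : ℝ) : ℂ) := rfl

theorem continuous_of_mem_hullMaps (hQ : WithSeminorms (fun p : Q => (p : Seminorm ℝ E)))
    (hπ : π.IsNonexpansive Q) {γ : C → C} (hγ : γ ∈ π.hullMaps) : Continuous γ :=
  nonexpansive_continuous hQ (π.nonexpansive_of_mem_hullMaps hQ hπ hγ)

/-- Equicontinuity of the hull on the compact set C turns pointwise convergence into uniform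
convergence. -/
theorem continuous_orbitFunction [CompactSpace C]
    (hQ : WithSeminorms (fun p : Q => (p : Seminorm ℝ E)))
    (hπ : π.IsNonexpansive Q) (x : C) (l : E →L[ℝ] ℝ) :
    Continuous fun γ : π.hullMaps =>
      π.orbitFunction x l (π.continuous_of_mem_hullMaps hQ hπ γ.2) := by
  refine continuous_bcf_of_finite_approx fun ε hε => ?_
  have hU : {e : E | |l e| < ε} ∈ 𝓝 (0 : E) := by
    refine (isOpen_lt (continuous_abs.comp l.continuous) continuous_const).mem_nhds ?_
    simpa using hε
  obtain ⟨t, ht⟩ := CompactSpace.elim_nhds_subcover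
    (fun c₀ : C => {c : C | ∀ γ : C → C,
      (∀ p ∈ Q, ∀ x y : C, p ((γ x : E) - γ y) ≤ p ((x : E) - y)) →
        (γ c : E) - γ c₀ ∈ {e : E | |l e| < ε}})
    fun c₀ => nonexpansive_eventually_mem hQ hU c₀
  refine ⟨(fun (c : C) (γ : π.hullMaps) => ((l (γ.1 c : E) : ℝ) : ℂ)) '' t,
    t.finite_toSet.image _, ?_, fun s => ?_⟩
  · rintro _ ⟨c, -, rfl⟩
    exact Complex.continuous_ofReal.comp (l.continuous.comp (continuous_subtype_val.comp
      ((continuous_apply c).comp continuous_subtype_val)))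
  · have hs : π.act s x ∈ (⊤ : Set C) := trivial
    rw [← ht] at hs
    obtain ⟨c, hc, hcs⟩ := Set.mem_iUnion₂.1 hs
    refine ⟨_, ⟨c, hc, rfl⟩, fun γ => ?_⟩
    have h := hcs γ.1 (π.nonexpansive_of_mem_hullMaps hQ hπ γ.2)
    rw [orbitFunction_apply, Complex.dist_eq, ← Complex.ofReal_sub, Complex.norm_real,
      ← map_sub]
    exact h.le

/-- Evaluated along an orbit, all maps in the hull have the same mean value. -/
theorem mean_orbitFunction_eq [T2Space E] [CompactSpace C] (hconv : Convex ℝ C)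
    (hQ : WithSeminorms (fun p : Q => (p : Seminorm ℝ E)))
    (hπ : π.IsNonexpansive Q) (x : C) (l : E →L[ℝ] ℝ) {m : S.AP →L[ℂ] ℂ}
    (hm : S.IsLeftInvariantMean m) {m' : (K →ᵇ ℂ) →L[ℂ] ℂ} (hm' : ∀ f : S.AP, m' f = m f)
    {γ : C → C} (hγ : γ ∈ π.hullMaps) :
    m' (π.orbitFunction x l (π.continuous_of_mem_hullMaps hQ hπ hγ))
      = m' (π.orbitFunction x l continuous_id) := by
  set Ξ : π.hullMaps → K →ᵇ ℂ := fun γ =>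
    π.orbitFunction x l (π.continuous_of_mem_hullMaps hQ hπ γ.2) with hΞ
  have hΞc : Continuous Ξ := π.continuous_orbitFunction hQ hπ x l
  have hcomp : CompactSpace π.hullMaps :=
    isCompact_iff_compactSpace.1 π.isClosed_hullMaps.isCompact
  set f : K →ᵇ ℂ := π.orbitFunction x l continuous_id
  -- The action identity says that the left translates of f are the values of Ξ at the maps `act t`;
  -- the compact range of Ξ then makes f almost periodic.
  have hLf : ∀ t, S.leftTranslate t f = Ξ ⟨π.act t, π.act_mem_hullMaps t⟩ := by
    intro t
    ext s
    change _ = ((l (π.act t (π.act s x) : E) : ℝ) : ℂ)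
    rw [π.act_act t s x l, S.leftTranslate_apply]
    exact integral_ofReal
  have hf : f ∈ S.AP := by
    have hr := isCompact_range hΞc
    refine hr.of_isClosed_subset isClosed_closure (closure_minimal ?_ hr.isClosed)
    rintro _ ⟨t, rfl⟩
    exact ⟨_, (hLf t).symm⟩
  have hbase : ∀ t, m' (Ξ ⟨π.act t, π.act_mem_hullMaps t⟩) = m' f := by
    intro t
    have h1 := hm.map_leftTranslate t ⟨f, hf⟩ ⟨_, leftTranslate_mem_AP hf t⟩ rfl
    rw [← hm', ← hm'] at h1
    rw [← hLf]
    exact h1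
  -- As `m'` ∘ Ξ is continuous and affine, this level set is closed and convex, so containing every
  -- `act t` it contains the whole hull.
  let W : Set (C → E) := (fun (γ : π.hullMaps) c => (γ.1 c : E)) '' {γ | m' (Ξ γ) = m' f}
  have hWc : IsClosed W :=
    ((isClosed_eq (m'.continuous.comp hΞc) continuous_const).isCompact.image
      (continuous_coe_maps.comp continuous_subtype_val)).isClosed
  have hWconv : Convex ℝ W := by
    rintro _ ⟨γ, hγ, rfl⟩ _ ⟨δ, hδ, rfl⟩ a b ha hb hab
    let η : C → C := fun c => ⟨a • (γ.1 c : E) + b • (δ.1 c : E),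
      hconv (γ.1 c).2 (δ.1 c).2 ha hb hab⟩
    have hη : η ∈ π.hullMaps := convex_closedConvexHull γ.2 δ.2 ha hb hab
    refine ⟨⟨η, hη⟩, ?_, rfl⟩
    have e : Ξ ⟨η, hη⟩ = (a : ℂ) • Ξ γ + (b : ℂ) • Ξ δ := by
      ext s
      change ((l (a • (γ.1 (π.act s x) : E) + b • (δ.1 (π.act s x) : E)) : ℝ) : ℂ)
        = (a : ℂ) • ((l (γ.1 (π.act s x) : E) : ℝ) : ℂ)
          + (b : ℂ) • ((l (δ.1 (π.act s x) : E) : ℝ) : ℂ)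
      rw [map_add, map_smul, map_smul]
      simp
    have hγ' : m' (Ξ γ) = m' f := hγ
    have hδ' : m' (Ξ δ) = m' f := hδ
    change m' (Ξ ⟨η, hη⟩) = m' f
    rw [e, map_add, map_smul, map_smul, hγ', hδ', ← add_smul, ← Complex.ofReal_add, hab]
    simp
  have hsub : Set.range (fun s c => (π.act s c : E)) ⊆ W := by
    rintro _ ⟨t, rfl⟩
    exact ⟨⟨π.act t, π.act_mem_hullMaps t⟩, hbase t, rfl⟩
  obtain ⟨δ, hδ, e⟩ := closedConvexHull_min hsub hWconv hWc hγ
  have : δ = ⟨γ, hγ⟩ := Subtype.ext (funext fun c => Subtype.ext (congrFun e c))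
  rw [this] at hδ
  exact hδ

theorem exists_isCommonFixedPoint [Nonempty K] [T2Space E] (hS : S.IsLeftAmenableAP)
    (hQ : WithSeminorms (fun p : Q => (p : Seminorm ℝ E))) (hC : IsCompact C)
    (hconv : Convex ℝ C) (hne : C.Nonempty) (hπ : π.IsNonexpansive Q) :
    ∃ x : C, π.IsCommonFixedPoint x := by
  have hcomp : CompactSpace C := isCompact_iff_compactSpace.1 hC
  have hlc : LocallyConvexSpace ℝ E := hQ.toLocallyConvexSpace
  obtain ⟨m, hm⟩ := hS
  -- The mean has to be evaluated at orbit functions of arbitrary hull maps, whose almost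
  -- periodicity is not established.
  obtain ⟨m', hm', -⟩ := exists_extension_norm_eq S.AP m
  have hcont : ∀ γ ∈ π.hullMaps, Continuous γ := fun γ hγ =>
    π.continuous_of_mem_hullMaps hQ hπ hγ
  -- Left composition by a non-affine map need not preserve convex combinations, so the hull itself
  -- may fail to be a semigroup. Γ keeps the maps that can be composed on the right with every hull
  -- map.
  let Γ : Set (C → C) := {γ | γ ∈ π.hullMaps ∧ ∀ δ ∈ π.hullMaps, δ ∘ γ ∈ π.hullMaps}
  have hact : ∀ s, π.act s ∈ Γ := fun s =>
    ⟨π.act_mem_hullMaps s, fun δ hδ => π.comp_act_mem_hullMaps hC hδ s⟩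
  have hmul : ∀ f ∈ Γ, ∀ g ∈ Γ, f ∘ g ∈ Γ := fun f hf g hg =>
    ⟨hg.2 f hf.1, fun δ hδ => hg.2 (δ ∘ f) (hf.2 δ hδ)⟩
  have hcl : IsClosed Γ := by
    have : Γ = π.hullMaps ∩ ⋂ δ ∈ π.hullMaps, (fun γ : C → C => δ ∘ γ) ⁻¹' π.hullMaps := by
      ext γ
      simp [Γ]
    rw [this]
    refine π.isClosed_hullMaps.inter (isClosed_biInter fun δ hδ => ?_)
    exact π.isClosed_hullMaps.preimage
      (continuous_pi fun c => (hcont δ hδ).comp (continuous_apply c))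
  obtain ⟨s₀⟩ := ‹Nonempty K›
  obtain ⟨j, hj, y, hy⟩ := exists_forall_apply_apply_eq hQ hC hconv hne hcl ⟨_, hact s₀⟩ hmul
    fun f hf => π.nonexpansive_of_mem_hullMaps hQ hπ hf.1
  have hone : m' 1 = 1 := (hm' ⟨1, S.one_mem_AP⟩).trans hm.map_one
  have hconst : ∀ (l : E →L[ℝ] ℝ) (γ : C → C) (hγ : γ ∈ π.hullMaps) (r : ℝ),
      (∀ s, l (γ (π.act s y) : E) = r) → m' (π.orbitFunction y l continuous_id) = r := by
    intro l γ hγ r h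
    rw [← π.mean_orbitFunction_eq hconv hQ hπ y l hm hm' hγ]
    have e : π.orbitFunction y l (π.continuous_of_mem_hullMaps hQ hπ hγ) = (r : ℂ) • 1 := by
      ext s
      rw [orbitFunction_apply, h s]
      simp
    rw [e, map_smul, hone, smul_eq_mul, mul_one]
  refine ⟨y, fun t => Subtype.ext ?_⟩
  refine (SeparatingDual.eq_iff_forall_dual_eq (R := ℝ)).2 fun l => ?_
  -- Along the orbit of y the map j is constantly y and `act t ∘ j` is constantly π(t, y); both must
  -- produce the same mean.
  have h1 := hconst l j hj.1 (l y) fun s => by rw [hy _ (hact s)]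
  have h2 := hconst l (π.act t ∘ j) (hmul _ (hact t) _ hj).1 (l (π.act t y)) fun s => by
    rw [Function.comp_apply, hy _ (hact s)]
  exact_mod_cast h2.symm.trans h1

end SepContAction
end SemitopologicalSemihypergroup
end Semihyper
end

/-! ### From common fixed points to an invariant mean -/

noncomputable section

namespace Semihyper
namespace SemitopologicalSemihypergroup

variable {K : Type u} [TopologicalSpace K] [MeasurableSpace K] [BorelSpace K] [T2Space K]
  [LocallyCompactSpace K] (S : SemitopologicalSemihypergroup K)

/-- Left translation as an operator on `AP(K)`. -/
def apTranslate (x : K) : S.AP →L[ℂ] S.AP :=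
  LinearMap.mkContinuous ((S.leftTranslate x).restrict fun _ hf => leftTranslate_mem_AP hf x) 1
    fun f => by
      rw [one_mul]
      exact S.norm_leftTranslate_le x f

theorem coe_apTranslate (x : K) (f : S.AP) :
    (S.apTranslate x f : K →ᵇ ℂ) = S.leftTranslate x f := rfl

theorem norm_apTranslate_le (x : K) (f : S.AP) : ‖S.apTranslate x f‖ ≤ ‖f‖ :=
  S.norm_leftTranslate_le x f

theorem apTranslate_one (x : K) :
    S.apTranslate x ⟨1, S.one_mem_AP⟩ = ⟨1, S.one_mem_AP⟩ :=
  Subtype.ext (S.leftTranslate_one x)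

theorem continuous_apTranslate (f : S.AP) : Continuous fun x => S.apTranslate x f :=
  continuous_induced_rng.2 (continuous_leftTranslate f.2)

theorem apply_apTranslate_apTranslate (φ : S.AP →L[ℂ] ℂ) (s t : K) (f : S.AP) :
    φ (S.apTranslate t (S.apTranslate s f)) = ∫ z, φ (S.apTranslate z f) ∂(S.pconv s t) := by
  obtain ⟨φ', hφ', -⟩ := exists_extension_norm_eq S.AP φ
  simp_rw [← hφ', coe_apTranslate]
  rw [leftTranslate_leftTranslate f.2]
  exact (φ'.integral_comp_comm (integrable_leftTranslate f.2 (S.pconv s t))).symm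

/-- The orbit `x ↦ φ (L_x f)` of a functional. -/
def orbit (φ : S.AP →L[ℂ] ℂ) (f : S.AP) : K →ᵇ ℂ :=
  BoundedContinuousFunction.ofNormedAddCommGroup (fun x => φ (S.apTranslate x f))
    (φ.continuous.comp (S.continuous_apTranslate f)) (‖φ‖ * ‖f‖) fun x =>
      (φ.le_opNorm _).trans (by gcongr; exact S.norm_apTranslate_le x f)

/-- The dual of `AP(K)`, embedded in a product of normed spaces by recording the values of a
functional on the orbits of all almost periodic functions. -/
def dualEmbedding (φ : S.AP →L[ℂ] ℂ) : ULift.{v} S.AP → ℂ × (K →ᵇ ℂ) :=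
  -- The orbit part makes translation non-expansive. The value φ(f) is kept for injectivity, as no
  -- identity of K is assumed. `ULift` only adjusts the universe.
  fun f => (φ f.down, S.orbit φ f.down)

theorem dualEmbedding_injective : Function.Injective (dualEmbedding.{u, v} S) := fun _ _ h =>
  ContinuousLinearMap.ext fun f => congrArg Prod.fst (congrFun h ⟨f⟩)

/-- The means on `AP(K)`, with the weak-* topology. -/
def means : Set (WeakDual ℂ S.AP) :=
  {φ | ‖WeakDual.toStrongDual φ‖ ≤ 1 ∧ φ ⟨1, S.one_mem_AP⟩ = 1}

theorem isCompact_means : IsCompact S.means := by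
  have h : IsCompact {φ : WeakDual ℂ S.AP | ‖WeakDual.toStrongDual φ‖ ≤ 1} := by
    convert WeakDual.isCompact_closedBall (0 : StrongDual ℂ S.AP) 1 using 1
    ext φ
    exact (mem_closedBall_zero_iff (E := StrongDual ℂ S.AP)).symm
  exact h.inter_right (isClosed_eq (WeakDual.eval_continuous _) continuous_const)

variable {S} in
theorem norm_le_of_mem_means {φ : WeakDual ℂ S.AP} (hφ : φ ∈ S.means) (f : S.AP) :
    ‖φ f‖ ≤ ‖f‖ :=
  ((WeakDual.toStrongDual φ).le_of_opNorm_le hφ.1 f).trans_eq (one_mul _)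

variable {S} in
theorem mem_means_of_norm_le {φ : WeakDual ℂ S.AP} (h : ∀ f, ‖φ f‖ ≤ ‖f‖)
    (h1 : φ ⟨1, S.one_mem_AP⟩ = 1) : φ ∈ S.means :=
  ⟨ContinuousLinearMap.opNorm_le_bound _ zero_le_one fun f => (h f).trans_eq (one_mul _).symm, h1⟩

theorem means_nonempty [Nonempty K] : S.means.Nonempty := by
  obtain ⟨k⟩ := ‹Nonempty K›
  exact ⟨StrongDual.toWeakDual ((BoundedContinuousFunction.evalCLM ℂ k).comp S.AP.subtypeL),
    mem_means_of_norm_le (fun f => (f : K →ᵇ ℂ).norm_coe_le_norm k) rfl⟩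

/-- The orbit of f has a finite ε-net and means have norm at most 1, so finitely many evaluations
control the whole orbit function up to ε. -/
theorem continuous_dualEmbedding :
    Continuous fun φ : S.means => dualEmbedding.{u, v} S (WeakDual.toStrongDual φ.1) := by
  refine continuous_pi fun f => Continuous.prodMk
    ((WeakDual.eval_continuous _).comp continuous_subtype_val) ?_
  refine continuous_bcf_of_finite_approx fun ε hε => ?_
  obtain ⟨t, hts, htf, ht⟩ := Metric.finite_approx_of_totallyBounded
    ((IsCompact.totallyBounded f.down.2).subset subset_closure) ε hε
  choose k hk using fun g : t => hts g.2
  have : Finite t := htf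
  refine ⟨Set.range fun (g : t) (φ : S.means) => φ.1 (S.apTranslate (k g) f.down),
    Set.finite_range _, ?_, fun x => ?_⟩
  · rintro _ ⟨g, rfl⟩
    exact (WeakDual.eval_continuous _).comp continuous_subtype_val
  · obtain ⟨g, hg, hx⟩ := Set.mem_iUnion₂.1 (ht ⟨x, rfl⟩)
    refine ⟨_, ⟨⟨g, hg⟩, rfl⟩, fun φ => ?_⟩
    have hx' : dist (S.leftTranslate x f.down) (S.leftTranslate (k ⟨g, hg⟩) f.down) < ε := by
      rw [show S.leftTranslate (k ⟨g, hg⟩) f.down = g from hk ⟨g, hg⟩]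
      exact hx
    change dist (φ.1 (S.apTranslate x f.down)) (φ.1 (S.apTranslate (k ⟨g, hg⟩) f.down)) ≤ ε
    rw [dist_eq_norm, ← map_sub]
    refine (norm_le_of_mem_means φ.2 _).trans ?_
    rw [← dist_eq_norm]
    exact hx'.le

/-- The set of means, as a subset of the product space. -/
def meansImage : Set (ULift.{v} S.AP → ℂ × (K →ᵇ ℂ)) :=
  Set.range fun φ : S.means => dualEmbedding.{u, v} S (WeakDual.toStrongDual φ.1)

instance : CompactSpace S.means := isCompact_iff_compactSpace.1 S.isCompact_means

/-- The means with the weak-* topology are homeomorphic to their image in the product. -/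
def meansHomeo : S.means ≃ₜ meansImage.{u, v} S :=
  Continuous.homeoOfEquivCompactToT2
    (f := Equiv.ofInjective _ fun _ _ h => Subtype.ext (dualEmbedding_injective.{u, v} S h))
    (continuous_induced_rng.2 (continuous_dualEmbedding.{u, v} S))

theorem isCompact_meansImage : IsCompact (meansImage.{u, v} S) :=
  isCompact_range (continuous_dualEmbedding.{u, v} S)

theorem convex_meansImage : Convex ℝ (meansImage.{u, v} S) := by
  rintro _ ⟨φ, rfl⟩ _ ⟨ψ, rfl⟩ a b ha hb hab
  refine ⟨⟨(a : ℂ) • φ.1 + (b : ℂ) • ψ.1, mem_means_of_norm_le (fun f => ?_) ?_⟩, ?_⟩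
  · change ‖(a : ℂ) • φ.1 f + (b : ℂ) • ψ.1 f‖ ≤ ‖f‖
    refine (norm_add_le _ _).trans ?_
    rw [norm_smul, norm_smul, Complex.norm_real, Complex.norm_real, Real.norm_of_nonneg ha,
      Real.norm_of_nonneg hb]
    calc a * ‖φ.1 f‖ + b * ‖ψ.1 f‖ ≤ a * ‖f‖ + b * ‖f‖ := by
          gcongr
          · exact norm_le_of_mem_means φ.2 f
          · exact norm_le_of_mem_means ψ.2 f
      _ = ‖f‖ := by rw [← add_mul, hab, one_mul]
  · change (a : ℂ) • φ.1 ⟨1, S.one_mem_AP⟩ + (b : ℂ) • ψ.1 ⟨1, S.one_mem_AP⟩ = 1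
    rw [φ.2.2, ψ.2.2, ← add_smul, ← Complex.ofReal_add, hab]
    simp
  · rfl

/-- The adjoint of a left translation, acting on means. -/
def translateMean (s : K) (φ : S.means) : S.means :=
  ⟨StrongDual.toWeakDual ((WeakDual.toStrongDual φ.1).comp (S.apTranslate s)),
    mem_means_of_norm_le
      (fun f => (norm_le_of_mem_means φ.2 _).trans (S.norm_apTranslate_le s f)) (by
        change φ.1 (S.apTranslate s ⟨1, S.one_mem_AP⟩) = 1
        rw [apTranslate_one]
        exact φ.2.2)⟩

theorem continuous_translateMean (s : K) : Continuous (S.translateMean s) :=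
  continuous_induced_rng.2 (WeakDual.continuous_of_continuous_eval fun f =>
    (WeakDual.eval_continuous (S.apTranslate s f)).comp continuous_subtype_val)

theorem continuous_translateMean_left (φ : S.means) :
    Continuous fun s => S.translateMean s φ :=
  continuous_induced_rng.2 (WeakDual.continuous_of_continuous_eval fun f =>
    (WeakDual.toStrongDual φ.1).continuous.comp (S.continuous_apTranslate f))

/-- The identity holds in each factor as a Bochner integral, checked by evaluations; functionals on
the product see only finitely many factors. -/
theorem dualEmbedding_translateMean (s t : K) (φ : S.means)
    (l : (ULift.{v} S.AP → ℂ × (K →ᵇ ℂ)) →L[ℝ] ℝ) :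
    l (meansHomeo.{u, v} S (S.translateMean s (S.translateMean t φ)))
      = ∫ z, l (meansHomeo.{u, v} S (S.translateMean z φ)) ∂(S.pconv s t) := by
  have hcont : Continuous fun z => (meansHomeo.{u, v} S (S.translateMean z φ) :
      ULift.{v} S.AP → ℂ × (K →ᵇ ℂ)) :=
    continuous_subtype_val.comp
      ((meansHomeo.{u, v} S).continuous.comp (S.continuous_translateMean_left φ))
  have hint : ∀ f : ULift.{v} S.AP, Integrable (fun z =>
      (meansHomeo.{u, v} S (S.translateMean z φ) : ULift.{v} S.AP → ℂ × (K →ᵇ ℂ)) f)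
      (S.pconv s t) := fun f =>
    integrable_of_continuous_of_forall_mem _ ((continuous_apply f).comp hcont)
      ((isCompact_meansImage.{u, v} S).image (continuous_apply f))
      fun z => ⟨_, (meansHomeo.{u, v} S (S.translateMean z φ)).2, rfl⟩
  have heq : ∀ f : ULift.{v} S.AP,
      (meansHomeo.{u, v} S (S.translateMean s (S.translateMean t φ)) :
        ULift.{v} S.AP → ℂ × (K →ᵇ ℂ)) f
      = ∫ z, (meansHomeo.{u, v} S (S.translateMean z φ) :
        ULift.{v} S.AP → ℂ × (K →ᵇ ℂ)) f ∂(S.pconv s t) := by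
    intro f
    refine Prod.ext ?_ (BoundedContinuousFunction.ext fun x => ?_)
    · refine Eq.trans ?_ ((ContinuousLinearMap.fst ℂ ℂ (K →ᵇ ℂ)).integral_comp_comm (hint f))
      exact S.apply_apTranslate_apTranslate φ.1 s t f.down
    · refine Eq.trans ?_ (((BoundedContinuousFunction.evalCLM ℂ x).comp
        (ContinuousLinearMap.snd ℂ ℂ (K →ᵇ ℂ))).integral_comp_comm (hint f))
      exact S.apply_apTranslate_apTranslate φ.1 s t (S.apTranslate x f.down)
  refine (apply_eq_integral_of_forall_coord (fun f l => l.integrable_comp (hint f))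
    (fun f l => ?_) l).2
  rw [heq f]
  exact (l.integral_comp_comm (hint f)).symm

/-- The action of `K` on the means of `AP(K)`. -/
def meanAction : S.SepContAction (meansImage.{u, v} S) where
  act s c := S.meansHomeo (S.translateMean s (S.meansHomeo.symm c))
  act_act s t c l := by
    rw [Homeomorph.symm_apply_apply]
    exact S.dualEmbedding_translateMean s t _ l
  act_identity e he c := by
    have h : S.translateMean e (S.meansHomeo.symm c) = S.meansHomeo.symm c := by
      refine Subtype.ext (ContinuousLinearMap.ext fun f => ?_)
      have hf : S.apTranslate e f = f := Subtype.ext (S.leftTranslate_identity he f)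
      exact congrArg (S.meansHomeo.symm c).1 hf
    rw [h, Homeomorph.apply_symm_apply]
  continuous_act s := (meansHomeo.{u, v} S).continuous.comp
    ((S.continuous_translateMean s).comp (meansHomeo.{u, v} S).symm.continuous)
  continuous_orbit c := (meansHomeo.{u, v} S).continuous.comp
    (S.continuous_translateMean_left _)

/-- The norms of the coordinates, as seminorms on the product space. -/
def coordSeminorms : Set (Seminorm ℝ (ULift.{v} S.AP → ℂ × (K →ᵇ ℂ))) :=
  Set.range fun f => (normSeminorm ℝ (ℂ × (K →ᵇ ℂ))).comp (LinearMap.proj f)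

theorem withSeminorms_coordSeminorms : WithSeminorms (fun p : coordSeminorms.{u, v} S =>
    (p : Seminorm ℝ (ULift.{v} S.AP → ℂ × (K →ᵇ ℂ)))) := by
  rw [SeminormFamily.withSeminorms_iff_nhds_eq_iInf, nhds_pi, Filter.pi]
  refine Eq.trans ?_ (iInf_range' (fun p : Seminorm ℝ (ULift.{v} S.AP → ℂ × (K →ᵇ ℂ)) =>
    (𝓝 (0 : ℝ)).comap p) _).symm
  refine iInf_congr fun f => ?_
  rw [Pi.zero_apply, ← comap_norm_nhds_zero, Filter.comap_comap]
  rfl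

/-- Each φ(L_s L_x f) is an average of values φ(L_z f), and φ(L_s f) is itself such a value, so
everything is bounded by the old orbit norm. General functionals are needed since this is applied to
differences of means. -/
theorem norm_dualEmbedding_comp_le (φ : S.AP →L[ℂ] ℂ) (s : K) (f : S.AP) :
    ‖(φ (S.apTranslate s f), S.orbit (φ.comp (S.apTranslate s)) f)‖
      ≤ ‖(φ f, S.orbit φ f)‖ := by
  have hle : ∀ x, ‖φ (S.apTranslate x f)‖ ≤ ‖S.orbit φ f‖ := fun x =>
    (S.orbit φ f).norm_coe_le_norm x
  refine le_trans (max_le (hle s) ?_) (le_max_right _ _)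
  refine (BoundedContinuousFunction.norm_le (norm_nonneg _)).2 fun x => ?_
  change ‖φ (S.apTranslate s (S.apTranslate x f))‖ ≤ _
  rw [apply_apTranslate_apTranslate]
  refine (norm_integral_le_of_norm_le_const (μ := S.pconv x s)
    (Filter.Eventually.of_forall hle)).trans ?_
  simp

theorem isNonexpansive_meanAction :
    (meanAction.{u, v} S).IsNonexpansive (coordSeminorms.{u, v} S) := by
  rintro _ ⟨f, rfl⟩ s c d
  obtain ⟨φ, rfl⟩ := (meansHomeo.{u, v} S).surjective c
  obtain ⟨ψ, rfl⟩ := (meansHomeo.{u, v} S).surjective d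
  change ‖((meansHomeo.{u, v} S (S.translateMean s ((meansHomeo.{u, v} S).symm _)) :
      ULift.{v} S.AP → ℂ × (K →ᵇ ℂ)) - meansHomeo.{u, v} S (S.translateMean s _)) f‖ ≤ _
  rw [Homeomorph.symm_apply_apply, Homeomorph.symm_apply_apply]
  exact S.norm_dualEmbedding_comp_le (WeakDual.toStrongDual φ.1 - WeakDual.toStrongDual ψ.1) s f.down

theorem isLeftAmenableAP_of_isCommonFixedPoint [Nonempty K] {c : meansImage.{u, v} S}
    (hc : (meanAction.{u, v} S).IsCommonFixedPoint c) : S.IsLeftAmenableAP := by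
  obtain ⟨φ, rfl⟩ := (meansHomeo.{u, v} S).surjective c
  have hfix : ∀ s, S.translateMean s φ = φ := fun s => by
    have h : meansHomeo.{u, v} S (S.translateMean s ((meansHomeo.{u, v} S).symm _)) = _ := hc s
    rw [Homeomorph.symm_apply_apply] at h
    exact (meansHomeo.{u, v} S).injective h
  refine ⟨WeakDual.toStrongDual φ.1, le_antisymm ?_ ?_, φ.2.2, fun x f g hg => ?_⟩
  · exact φ.2.1
  · have h := (WeakDual.toStrongDual φ.1).le_opNorm ⟨1, S.one_mem_AP⟩
    have h1 : WeakDual.toStrongDual φ.1 ⟨1, S.one_mem_AP⟩ = 1 := φ.2.2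
    have h2 : ‖(⟨1, S.one_mem_AP⟩ : S.AP)‖ = 1 := norm_one (α := K →ᵇ ℂ)
    rwa [h1, h2, norm_one, mul_one] at h
  · have h : g = S.apTranslate x f := Subtype.ext hg
    rw [h]
    exact congrArg (fun ψ : S.means => ψ.1 f) (hfix x)

end SemitopologicalSemihypergroup
end Semihyper
end

theorem theorem3p4 {K : Type u} [TopologicalSpace K] [T2Space K] [LocallyCompactSpace K]
    [MeasurableSpace K] [BorelSpace K] [Nonempty K]
    (S : Semihyper.SemitopologicalSemihypergroup K) :
    S.IsLeftAmenableAP ↔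
      ∀ (E : Type (max u v)) [AddCommGroup E] [Module ℝ E] [TopologicalSpace E]
        [IsTopologicalAddGroup E] [ContinuousSMul ℝ E] [T2Space E]
        (Q : Set (Seminorm ℝ E)), WithSeminorms (fun p : Q => (p : Seminorm ℝ E)) →
        ∀ C : Set E, IsCompact C → Convex ℝ C → C.Nonempty →
        ∀ π : S.SepContAction C, π.IsNonexpansive Q → ∃ x : C, π.IsCommonFixedPoint x := by
  refine ⟨fun hS E _ _ _ _ _ _ Q hQ C hC hconv hne π hπ =>
    π.exists_isCommonFixedPoint hS hQ hC hconv hne hπ, fun h => ?_⟩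
  have hne : (Semihyper.SemitopologicalSemihypergroup.meansImage.{u, v} S).Nonempty := by
    have := S.means_nonempty.to_subtype
    exact Set.range_nonempty _
  obtain ⟨c, hc⟩ := h _ S.coordSeminorms S.withSeminorms_coordSeminorms _
    S.isCompact_meansImage S.convex_meansImage hne S.meanAction S.isNonexpansive_meanAction
  exact S.isLeftAmenableAP_of_isCommonFixedPoint hc
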